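/- Write $\mathcal M_+$ for the set of Lebesgue measurable functions $f\colon(0,1)\to[0,\infty]$, $f^*(t)=\inf\{\lambda\ge 0: |\{f>\lambda\}|\le t\}$ for the nonincreasing rearrangement, $f^{**}(t)=\frac1t\int_0^t f^*(s)\,ds$, and $\|f\|_1=\int_0^1 f$. An r.i. norm is a map $\rho\colon\mathcal M_+\to[0,\infty]$ such that for all $f,g,f_n\in\mathcal M_+$ and $a\ge0$: $\rho(f)=0$ iff $f=0$ a.e., $\rho(af)=a\rho(f)$, $\rho(f+g)\le\rho(f)+\rho(g)$; $f\le g$ a.e. implies $\rho(f)\le\rho(g)$; $f_n\nearrow f$ a.e. implies $\rho(f_n)\nearrow\rho(f)$; $\rho(1)<\infty$; $\|f\|_1\le C_\rho\,\rho(f)$ with a constant $C_\rho$ independent of $f$; $\rho(f)=\rho(f^*)$. An r.i. space $X$ is given by such a norm, written $\|\cdot\|_X$, and its associate space $X'$ by $\|f\|_{X'}=\sup\{\int_0^1 fg: g\in\mathcal M_+,\ \|g\|_X\le1\}$. An operator $T$ on $\mathcal M_+$ is bounded from $X$ to $Y$ if there is $C<\infty$ with $\|Tf\|_Y\le C\|f\|_X$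 for all $f\in\mathcal M_+$ with $\|f\|_X<\infty$. An r.i. space $Y$ is an optimal target space for $X$ under $T$ if $T$ is bounded from $X$ to $Y$ and, whenever $T$ is bounded from $X$ to an r.i. space $Z$, the identity is bounded from $Y$ to $Z$. Let $\mathcal Q$ be the class of bijections $I\colon(0,1)\to(0,1)$ such that $I$ is nondecreasing, $t\mapsto I(t)/t$ is nonincreasing, the three estimates $$\int_0^t\frac{I(s)}{s}\,ds\lesssim I(t),\qquad \int_0^t\frac{ds}{I(s)}\lesssim\frac{t}{I(t)},\qquad \int_t^1\frac{I(s)}{s^2}\,ds\lesssim\frac1t\int_0^t\frac{I(s)}{s}\,ds$$ hold for $t\in(0,1)$ with constants independent of $t$, and $(1-c)d\le c$, where $$c=\sup\Big\{\lambda\ge0:\ \lambda\Big(\frac{I(t)}{t^2}-1\Big)\le\int_t^1\frac{I(s)}{s^3}\,ds\ \text{ for all } t\in(0,1)\Big\}$$ and $d$ is the smallest positive number such that $\int_t^1\frac{I(s)}{s^2}\,ds\le d\,\frac{I(t)}{t}$ for all $t\in(0,1)$. For $I\in\mathcal Q$, $f\in\mathcal M_+$ and $t\in(0,1)$ put $$H_If(t)=\int_t^1\frac{f(s)}{I(s)}\,ds,\qquad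 S_If(t)=\frac1{I(t)}\sup_{0<s\le t}I(s)f^*(s).$$ **Theorem.** Let $I\in\mathcal Q$ and let $X$ be an r.i. space such that $S_I$ is bounded on $X'$ (that is, from $X'$ to $X'$). Then an optimal target space for $X$ under $H_I$ exists, and for every such optimal target space $Y_X$ there is a constant $C<\infty$ such that for all $f\in\mathcal M_+$ $$\frac1C\,\|f\|_{Y_X}\ \le\ \Big\|\frac{I(t)}{t}\big(f^{**}(t)-f^*(t)\big)\Big\|_X+\|f\|_1\ \le\ C\,\|f\|_{Y_X},$$ where $f^{**}(t)-f^*(t)$ is read as $0$ at points where both terms are infinite (this happens only if $\|f\|_1=\infty$, in which case the sum in the middle and $\|f\|_{Y_X}$ are both infinite). -/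

import Mathlib

open MeasureTheory Set Filter Topology
open scoped ENNReal NNReal

noncomputable section

namespace RISpace

/-- Lebesgue measure on the unit interval `(0, 1)`. -/
def unitMeasure : Measure ℝ := volume.restrict (Ioo (0 : ℝ) 1)

/-- Membership in `M₊(0, 1)`: a Lebesgue measurable function with values in `[0, ∞]`. Functions are
defined on all of `ℝ`, but only their restriction to `(0, 1)` matters. -/
def MeasPos (f : ℝ → ℝ≥0∞) : Prop := AEMeasurable f unitMeasure

/-- The nonincreasing rearrangement `f*`. -/
def rearr (f : ℝ → ℝ≥0∞) (t : ℝ) : ℝ≥0∞ :=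
  sInf {r : ℝ≥0∞ | unitMeasure {x | r < f x} ≤ ENNReal.ofReal t}

/-- The maximal nonincreasing rearrangement `f**(t) = (1/t) ∫₀ᵗ f*(s) ds`. -/
def maxRearr (f : ℝ → ℝ≥0∞) (t : ℝ) : ℝ≥0∞ :=
  (∫⁻ s in Ioo 0 t, rearr f s) / ENNReal.ofReal t

/-- The `L¹(0, 1)` norm. -/
def normL1 (f : ℝ → ℝ≥0∞) : ℝ≥0∞ := ∫⁻ t, f t ∂unitMeasure

/-- Rearrangement-invariant Banach function norms on `M₊(0, 1)`. The value of `ρ` on functions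
outside `M₊(0, 1)` is irrelevant. -/
structure IsRINorm (ρ : (ℝ → ℝ≥0∞) → ℝ≥0∞) : Prop where
  eq_zero_iff : ∀ f, MeasPos f → (ρ f = 0 ↔ f =ᵐ[unitMeasure] 0)
  smul : ∀ (a : ℝ≥0) (f : ℝ → ℝ≥0∞), MeasPos f → ρ (fun t => (a : ℝ≥0∞) * f t) = a * ρ f
  add_le : ∀ f g, MeasPos f → MeasPos g → ρ (fun t => f t + g t) ≤ ρ f + ρ g
  mono : ∀ f g, MeasPos f → MeasPos g → f ≤ᵐ[unitMeasure] g → ρ f ≤ ρ g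
  fatou : ∀ (f : ℕ → ℝ → ℝ≥0∞) (g : ℝ → ℝ≥0∞), (∀ n, MeasPos (f n)) → MeasPos g →
    (∀ᵐ t ∂unitMeasure, Monotone (fun n => f n t) ∧
      Tendsto (fun n => f n t) atTop (𝓝 (g t))) →
    Tendsto (fun n => ρ (f n)) atTop (𝓝 (ρ g))
  one_lt_top : ρ (fun _ => 1) < ∞
  lintegral_le : ∃ C : ℝ≥0, ∀ f, MeasPos f → normL1 f ≤ C * ρ f
  rearr_eq : ∀ f, MeasPos f → ρ f = ρ (rearr f)

/-- The associate norm `ρ'(f) = sup {∫₀¹ f g : ρ(g) ≤ 1}`. -/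
def assoc (ρ : (ℝ → ℝ≥0∞) → ℝ≥0∞) (f : ℝ → ℝ≥0∞) : ℝ≥0∞ :=
  ⨆ (g : ℝ → ℝ≥0∞) (_ : MeasPos g) (_ : ρ g ≤ 1), ∫⁻ t, f t * g t ∂unitMeasure

/-- Boundedness of an operator `T` on `M₊(0, 1)` from the space with norm `ρ` to the space with
norm `σ`. -/
def IsBoundedOp (T : (ℝ → ℝ≥0∞) → ℝ → ℝ≥0∞) (ρ σ : (ℝ → ℝ≥0∞) → ℝ≥0∞) : Prop :=
  ∃ C : ℝ≥0, ∀ f, MeasPos f → ρ f < ∞ → σ (T f) ≤ C * ρ f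

/-- The space with r.i. norm `σ` is an optimal target space, under `T`, for the space with
norm `ρ`: the smallest r.i. space into which `T` maps the latter boundedly. -/
def IsOptimalTarget (T : (ℝ → ℝ≥0∞) → ℝ → ℝ≥0∞) (ρ σ : (ℝ → ℝ≥0∞) → ℝ≥0∞) : Prop :=
  IsRINorm σ ∧ IsBoundedOp T ρ σ ∧
    ∀ τ : (ℝ → ℝ≥0∞) → ℝ≥0∞, IsRINorm τ → IsBoundedOp T ρ τ → IsBoundedOp id σ τ

/-- `H_I f(t) = ∫ₜ¹ f(s) / I(s) ds`. -/
def opH (I : ℝ → ℝ) (f : ℝ → ℝ≥0∞) (t : ℝ) : ℝ≥0∞ :=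
  ∫⁻ s in Ioo t 1, f s / ENNReal.ofReal (I s)

/-- `S_I f(t) = (1 / I(t)) sup_{0 < s ≤ t} I(s) f*(s)`. -/
def opS (I : ℝ → ℝ) (f : ℝ → ℝ≥0∞) (t : ℝ) : ℝ≥0∞ :=
  (⨆ s ∈ Ioc 0 t, ENNReal.ofReal (I s) * rearr f s) / ENNReal.ofReal (I t)

/-- The class `Q` of quasiconcave bijections `I` of `(0, 1)` onto itself. Only the values of `I`
on `(0, 1)` matter. -/
structure ClassQ (I : ℝ → ℝ) : Prop where
  bijOn : BijOn I (Ioo 0 1) (Ioo 0 1)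
  monotoneOn : MonotoneOn I (Ioo 0 1)
  antitoneOn_div : AntitoneOn (fun t => I t / t) (Ioo 0 1)
  /-- `∫₀ᵗ I(s)/s ds ≲ I(t)` -/
  integral_div_le : ∃ C : ℝ≥0, ∀ t ∈ Ioo (0 : ℝ) 1,
    ∫⁻ s in Ioo 0 t, ENNReal.ofReal (I s / s) ≤ C * ENNReal.ofReal (I t)
  /-- the average property `∫₀ᵗ ds/I(s) ≲ t/I(t)` -/
  average : ∃ C : ℝ≥0, ∀ t ∈ Ioo (0 : ℝ) 1,
    ∫⁻ s in Ioo 0 t, ENNReal.ofReal (1 / I s) ≤ C * ENNReal.ofReal (t / I t)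
  /-- `∫ₜ¹ I(s)/s² ds ≲ (1/t) ∫₀ᵗ I(s)/s ds` -/
  integral_div_sq_le : ∃ C : ℝ≥0, ∀ t ∈ Ioo (0 : ℝ) 1,
    ∫⁻ s in Ioo t 1, ENNReal.ofReal (I s / s ^ 2) ≤
      C * (ENNReal.ofReal (1 / t) * ∫⁻ s in Ioo 0 t, ENNReal.ofReal (I s / s))
  /-- `(1 - c) d ≤ c` for the best constants `c` and `d` -/
  constants : ∃ c d : ℝ,
    IsLUB {r : ℝ | 0 ≤ r ∧ ∀ t ∈ Ioo (0 : ℝ) 1,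
      r * (I t / t ^ 2 - 1) ≤ ∫ s in t..1, I s / s ^ 3} c ∧
    IsLeast {r : ℝ | 0 < r ∧ ∀ t ∈ Ioo (0 : ℝ) 1,
      ∫ s in t..1, I s / s ^ 2 ≤ r * (I t / t)} d ∧
    (1 - c) * d ≤ c

end RISpace

end

/-!
The proof compares everything with one explicit norm. Duality suggests that the optimal target norm
is the supremum of `∫ f* g` over the nonincreasing weights `g` for which `(1 / I(t)) ∫₀ᵗ g` lies in
the unit ball of the associate space `X'`; this is `targetNorm I X`. Because only rearrangements
enter its definition, it is an r.i. norm by Hardy's lemma and the subadditivity of `f ↦ f**`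
(`isRINorm_targetNorm`), and Tonelli's theorem shows that `H_I` maps `X` into it
(`isBoundedOp_targetNorm`).

*Upper bounds for target norms.* Since `f**` has derivative `-(f** - f*) / t`, it is recovered as
`f** = ‖f‖₁ + H_I g` with `g = (I(t) / t) (f** - f*)`. Hence any r.i. space `Z` into which `H_I`
maps `X` satisfies `‖f‖_Z ≤ C (‖g‖_X + ‖f‖₁)` (`exists_le_oscillation_of_isBoundedOp`).

*Lower bound for the constructed norm.* It remains to bound `‖g‖_X` by the dual norm
(`exists_oscillation_le_targetNorm`). By the Lorentz–Luxemburg theorem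
(`le_of_forall_assoc_le_one`, proved by separating convex sets in `L²`) one pairs `g` with a bounded
`h` in the unit ball of `X'`. A layer-cake computation gives `∫ g h ≤ ∫₀^∞ φ(|{f > l}|) dl` with
`φ(a) = a ∫ₐ¹ I(s) h(s) / s² ds`, while `∫ f* w = ∫₀^∞ ∫₀^{|{f > l}|} w dl`; so a nonincreasing
`w` is wanted with `φ(a) ≤ ∫₀ᵃ w` and with `(1 / I(t)) ∫₀ᵗ w` controlled in `X'`. The function
`sup_{a ≤ t} φ(a)` is quasiconcave, hence equivalent to the primitive of such a `w`
(`exists_antitone_primitive`). It is dominated by `I(t) S_I(φ / I)(t)` (`tailSup_le_opS`), where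
`S_I` is bounded on `X'` by hypothesis, and where `h ↦ φ / I` is bounded on `X'` because it is
bounded on `L¹` and on `L^∞` (`exists_assoc_averageTailOp_le`). This interpolation rests on the
resonance property `lintegral_rearr_mul_le_assoc`, obtained from a measure-preserving map
`σ = rankMap h` with `h* ∘ σ ≤ h`.

The two bounds show that `targetNorm I X` is optimal and equivalent to the oscillation functional;
any other optimal target norm is equivalent to it.
-/

noncomputable section

namespace RISpace

/-! ### Lebesgue measure on the unit interval -/

instance : IsProbabilityMeasure unitMeasure :=
  ⟨by simp [unitMeasure]⟩

instance : NullSingletonClass unitMeasure := by unfold unitMeasure; infer_instance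

lemma ae_mem_unit : ∀ᵐ t ∂unitMeasure, t ∈ Ioo (0 : ℝ) 1 :=
  ae_restrict_mem measurableSet_Ioo

lemma setLIntegral_unitMeasure {s : Set ℝ} (hs : MeasurableSet s) (f : ℝ → ℝ≥0∞) :
    ∫⁻ t in s, f t ∂unitMeasure = ∫⁻ t in s ∩ Ioo 0 1, f t := by
  rw [unitMeasure, Measure.restrict_restrict hs]

lemma unitMeasure_Iio_le (a : ℝ) : unitMeasure (Iio a) ≤ ENNReal.ofReal a := by
  rw [unitMeasure, Measure.restrict_apply measurableSet_Iio]
  calc volume (Iio a ∩ Ioo 0 1) ≤ volume (Ioo 0 a) := measure_mono fun x hx => ⟨hx.2.1, hx.1⟩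
    _ = ENNReal.ofReal a := by simp

lemma unitMeasure_Iio {a : ℝ} (ha : a ≤ 1) : unitMeasure (Iio a) = ENNReal.ofReal a := by
  have : Iio a ∩ Ioo 0 1 = Ioo 0 a := by
    ext x; simp only [mem_inter_iff, mem_Iio, mem_Ioo]
    constructor
    · exact fun h => ⟨h.2.1, h.1⟩
    · exact fun h => ⟨h.2, h.1, h.2.trans_le ha⟩
  rw [unitMeasure, Measure.restrict_apply measurableSet_Iio, this]
  simp

/-! ### The nonincreasing rearrangement -/

/-- The rearrangement is the generalized inverse of the distribution function. Measurability of `f`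
is not needed: the superlevel sets increase as the level decreases to `r`. -/
lemma lt_rearr_iff (f : ℝ → ℝ≥0∞) (r : ℝ≥0∞) (t : ℝ) :
    r < rearr f t ↔ ENNReal.ofReal t < unitMeasure {x | r < f x} := by
  constructor
  · intro h
    by_contra! hc
    exact absurd h (not_lt.2 (sInf_le hc))
  · intro h
    by_contra! hc
    refine absurd h (not_lt.2 ?_)
    rcases eq_or_ne r ∞ with rfl | hr
    · simp
    obtain ⟨u, hu, hur, hlim⟩ := exists_seq_strictAnti_tendsto' (lt_top_iff_ne_top.2 hr)
    have hset : {x | r < f x} = ⋃ n, {x | u n < f x} := by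
      ext x
      simp only [mem_ofPred_eq, mem_iUnion]
      constructor
      · intro hx
        exact (hlim.eventually (gt_mem_nhds hx)).exists
      · rintro ⟨n, hn⟩
        exact (hur n).1.trans hn
    have hmono : Monotone fun n => {x | u n < f x} := fun m n hmn x hx =>
      (hu.antitone hmn).trans_lt hx
    rw [hset, hmono.measure_iUnion]
    refine iSup_le fun n => ?_
    obtain ⟨r', hr', hlt⟩ := sInf_lt_iff.1 (hc.trans_lt (hur n).1)
    exact (measure_mono fun x hx => hlt.trans hx).trans hr'

lemma rearr_le_iff (f : ℝ → ℝ≥0∞) (r : ℝ≥0∞) (t : ℝ) :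
    rearr f t ≤ r ↔ unitMeasure {x | r < f x} ≤ ENNReal.ofReal t := by
  rw [← not_lt, lt_rearr_iff, not_lt]

lemma rearr_antitone (f : ℝ → ℝ≥0∞) : Antitone (rearr f) := fun _ _ h =>
  sInf_le_sInf fun _ hr => le_trans hr (ENNReal.ofReal_le_ofReal h)

lemma measurable_rearr (f : ℝ → ℝ≥0∞) : Measurable (rearr f) := (rearr_antitone f).measurable

lemma measPos_rearr (f : ℝ → ℝ≥0∞) : MeasPos (rearr f) := (measurable_rearr f).aemeasurable

lemma rearr_mono {f g : ℝ → ℝ≥0∞} (h : f ≤ᵐ[unitMeasure] g) (t : ℝ) : rearr f t ≤ rearr g t :=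
  sInf_le_sInf fun r hr => le_trans (measure_mono_ae <| by
    filter_upwards [h] with x hx hr using lt_of_lt_of_le hr hx) hr

lemma rearr_congr {f g : ℝ → ℝ≥0∞} (h : f =ᵐ[unitMeasure] g) : rearr f = rearr g :=
  funext fun t => le_antisymm (rearr_mono h.le t) (rearr_mono h.symm.le t)

/-- The superlevel sets of the rearrangement are initial intervals of `(0, 1)`. -/
lemma setOf_lt_rearr (f : ℝ → ℝ≥0∞) (r : ℝ≥0∞) :
    {t | r < rearr f t} ∩ Ioo 0 1 = Ioo 0 (unitMeasure {x | r < f x}).toReal := by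
  have hle : (unitMeasure {x | r < f x}).toReal ≤ 1 :=
    ENNReal.toReal_le_of_le_ofReal zero_le_one (by simpa using prob_le_one)
  ext t
  simp only [mem_inter_iff, mem_ofPred_eq, mem_Ioo, lt_rearr_iff]
  constructor
  · rintro ⟨h, h0, -⟩
    exact ⟨h0, (ENNReal.ofReal_lt_iff_lt_toReal h0.le (measure_ne_top _ _)).1 h⟩
  · rintro ⟨h0, h⟩
    exact ⟨(ENNReal.ofReal_lt_iff_lt_toReal h0.le (measure_ne_top _ _)).2 h, h0, h.trans_le hle⟩

/-- A function and its rearrangement are equimeasurable. -/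
lemma unitMeasure_lt_rearr (f : ℝ → ℝ≥0∞) (r : ℝ≥0∞) :
    unitMeasure {t | r < rearr f t} = unitMeasure {x | r < f x} := by
  have hm : MeasurableSet {t | r < rearr f t} := measurableSet_lt measurable_const
    (measurable_rearr f)
  rw [unitMeasure, Measure.restrict_apply hm, setOf_lt_rearr, ← unitMeasure, Real.volume_Ioo,
    sub_zero, ENNReal.ofReal_toReal (measure_ne_top _ _)]

lemma rearr_eq_of_equimeasurable {f g : ℝ → ℝ≥0∞}
    (h : ∀ r, unitMeasure {x | r < f x} = unitMeasure {x | r < g x}) : rearr f = rearr g := by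
  funext t; simp only [rearr, h]

lemma rearr_rearr (f : ℝ → ℝ≥0∞) : rearr (rearr f) = rearr f :=
  rearr_eq_of_equimeasurable (unitMeasure_lt_rearr f)

/-- On `(0, 1)` strict inequality can occur only where `f` fails to be right-continuous. -/
lemma rearr_le_of_antitone {f : ℝ → ℝ≥0∞} (hf : Antitone f) (t : ℝ) : rearr f t ≤ f t := by
  rw [rearr_le_iff]
  refine (measure_mono fun x hx => ?_).trans (unitMeasure_Iio_le t)
  by_contra hc
  exact absurd hx (not_lt.2 (hf (not_lt.1 hc)))

lemma rearr_const_mul (a : ℝ≥0) (f : ℝ → ℝ≥0∞) (t : ℝ) :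
    rearr (fun x => (a : ℝ≥0∞) * f x) t = a * rearr f t := by
  rcases eq_or_ne a 0 with rfl | ha
  · simp only [ENNReal.coe_zero, zero_mul]
    exact le_antisymm ((rearr_le_iff _ _ _).2 (by simp)) zero_le
  have ha' : (a : ℝ≥0∞) ≠ 0 := by simpa using ha
  refine eq_of_forall_ge_iff fun r => ?_
  rw [rearr_le_iff, mul_comm, ← ENNReal.le_div_iff_mul_le (Or.inl ha') (Or.inl ENNReal.coe_ne_top),
    rearr_le_iff]
  have : {x | r < (a : ℝ≥0∞) * f x} = {x | r / a < f x} := by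
    ext x
    simp only [mem_ofPred_eq]
    rw [mul_comm, ENNReal.div_lt_iff (Or.inl ha') (Or.inl ENNReal.coe_ne_top)]
  rw [this]

lemma rearr_eq_iSup {f : ℕ → ℝ → ℝ≥0∞} {g : ℝ → ℝ≥0∞}
    (h : ∀ᵐ t ∂unitMeasure, Monotone (fun n => f n t) ∧
      Tendsto (fun n => f n t) atTop (𝓝 (g t))) (t : ℝ) :
    rearr g t = ⨆ n, rearr (f n) t := by
  refine le_antisymm (le_of_forall_lt fun r hr => ?_) (iSup_le fun n => rearr_mono ?_ t)
  · rw [lt_rearr_iff] at hr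
    have hmono : ∀ m n, m ≤ n → f m ≤ᵐ[unitMeasure] f n := fun m n hmn => by
      filter_upwards [h] with x hx using hx.1 hmn
    have : {x | r < g x} ≤ᵐ[unitMeasure] (⋃ n, {x | r < f n x} : Set ℝ) := by
      filter_upwards [h] with x hx hr
      exact mem_iUnion.2 (hx.2.eventually (lt_mem_nhds hr)).exists
    have h2 := hr.trans_le (measure_mono_ae this)
    have h3 : unitMeasure (⋃ n, {x | r < f n x}) = ⨆ n, unitMeasure {x | r < f n x} := by
      refine le_antisymm ?_
        (iSup_le fun n => measure_mono (subset_iUnion (fun n => {x | r < f n x}) n))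
      rw [measure_iUnion_eq_iSup_accumulate]
      refine iSup_mono fun n => measure_mono_ae ?_
      filter_upwards [h] with x hx hr
      obtain ⟨m, hm, hmr⟩ := mem_accumulate.1 hr
      exact lt_of_lt_of_le hmr (hx.1 hm)
    rw [h3] at h2
    obtain ⟨n, hn⟩ := lt_iSup_iff.1 h2
    exact lt_iSup_iff.2 ⟨n, (lt_rearr_iff _ _ _).2 hn⟩
  · filter_upwards [h] with x hx using hx.1.ge_of_tendsto hx.2 n

/-! ### Layer-cake formulas and Hardy's lemma -/

/-- The value `x ∈ [0, ∞]` as the length of the set of real levels below it. -/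
lemma volume_Ioi_inter_ofReal_lt (x : ℝ≥0∞) :
    volume (Ioi (0 : ℝ) ∩ {l | ENNReal.ofReal l < x}) = x := by
  rcases eq_or_ne x ∞ with rfl | hx
  · simp [ENNReal.ofReal_lt_top]
  · have : Ioi (0 : ℝ) ∩ {l | ENNReal.ofReal l < x} = Ioo 0 x.toReal := by
      ext l
      simp only [mem_inter_iff, mem_Ioi, mem_ofPred_eq, mem_Ioo]
      refine and_congr_right fun h => ENNReal.ofReal_lt_iff_lt_toReal h.le hx
    rw [this]; simp [hx]

lemma lintegral_mul_layer {m : Measure ℝ} [SFinite m] {f w : ℝ → ℝ≥0∞} (hf : Measurable f)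
    (hw : AEMeasurable w m) :
    ∫⁻ x, f x * w x ∂m =
      ∫⁻ l in Ioi (0 : ℝ), ∫⁻ x in {x | ENNReal.ofReal l < f x}, w x ∂m := by
  have hS : MeasurableSet {p : ℝ × ℝ | ENNReal.ofReal p.2 < f p.1} :=
    measurableSet_lt (ENNReal.measurable_ofReal.comp measurable_snd) (hf.comp measurable_fst)
  have h1 : ∀ x, f x * w x = ∫⁻ l in Ioi (0 : ℝ),
      {p : ℝ × ℝ | ENNReal.ofReal p.2 < f p.1}.indicator (fun p => w p.1) (x, l) := by
    intro x
    have hm : MeasurableSet {l : ℝ | ENNReal.ofReal l < f x} :=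
      measurableSet_lt ENNReal.measurable_ofReal measurable_const
    have : (fun l => {p : ℝ × ℝ | ENNReal.ofReal p.2 < f p.1}.indicator (fun p => w p.1) (x, l))
        = {l : ℝ | ENNReal.ofReal l < f x}.indicator fun _ => w x := by
      ext l; simp [indicator_apply]
    rw [this, lintegral_indicator hm, setLIntegral_const, Measure.restrict_apply hm, inter_comm,
      volume_Ioi_inter_ofReal_lt, mul_comm]
  simp_rw [h1]
  rw [lintegral_lintegral_swap]
  · refine lintegral_congr fun l => ?_
    rw [← lintegral_indicator (measurableSet_lt measurable_const hf)]
    rfl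
  · exact (hw.comp_fst).indicator hS

lemma lintegral_layer {m : Measure ℝ} [SFinite m] {f : ℝ → ℝ≥0∞} (hf : AEMeasurable f m) :
    ∫⁻ x, f x ∂m = ∫⁻ l in Ioi (0 : ℝ), m {x | ENNReal.ofReal l < f x} := by
  have h := lintegral_mul_layer hf.measurable_mk (w := fun _ => 1) aemeasurable_const (m := m)
  simp only [mul_one, setLIntegral_one] at h
  rw [lintegral_congr_ae hf.ae_eq_mk, h]
  refine lintegral_congr fun l => measure_congr ?_
  filter_upwards [hf.ae_eq_mk] with x hx
  exact congrArg (ENNReal.ofReal l < ·) hx.symm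

/-- Hardy's lemma. -/
lemma lintegral_mul_le_of_antitone {a b w : ℝ → ℝ≥0∞} (ha : MeasPos a) (hb : MeasPos b)
    (hw : Antitone w)
    (h : ∀ t ∈ Ioc (0 : ℝ) 1, ∫⁻ s in Ioo 0 t, a s ≤ ∫⁻ s in Ioo 0 t, b s) :
    ∫⁻ t, a t * w t ∂unitMeasure ≤ ∫⁻ t, b t * w t ∂unitMeasure := by
  simp_rw [mul_comm _ (w _)]
  rw [lintegral_mul_layer hw.measurable ha, lintegral_mul_layer hw.measurable hb]
  refine lintegral_mono fun l => ?_
  have hm : MeasurableSet {x | ENNReal.ofReal l < w x} :=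
    measurableSet_lt measurable_const hw.measurable
  rw [setLIntegral_unitMeasure hm, setLIntegral_unitMeasure hm]
  set S := {x | ENNReal.ofReal l < w x} ∩ Ioo 0 1 with hS
  rcases S.eq_empty_or_nonempty with hE | ⟨x₀, hx₀⟩
  · simp [hE]
  have hbdd : BddAbove S := ⟨1, fun x hx => hx.2.2.le⟩
  have hsub : S ⊆ Ioc 0 (sSup S) := fun x hx => ⟨hx.2.1, le_csSup hbdd hx⟩
  have hsup : Ioo 0 (sSup S) ⊆ S := fun x hx => by
    obtain ⟨y, hy, hxy⟩ := exists_lt_of_lt_csSup ⟨x₀, hx₀⟩ hx.2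
    exact ⟨lt_of_lt_of_le hy.1 (hw hxy.le), hx.1, hxy.trans hy.2.2⟩
  calc ∫⁻ t in S, a t ≤ ∫⁻ t in Ioc 0 (sSup S), a t := lintegral_mono_set hsub
    _ = ∫⁻ t in Ioo 0 (sSup S), a t := by rw [restrict_Ioo_eq_restrict_Ioc]
    _ ≤ ∫⁻ t in Ioo 0 (sSup S), b t :=
      h _ ⟨hx₀.2.1.trans_le (le_csSup hbdd hx₀), csSup_le ⟨x₀, hx₀⟩ fun x hx => hx.2.2.le⟩
    _ ≤ ∫⁻ t in S, b t := lintegral_mono_set hsup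

/-- Among the sets of given measure, the mass of `h*` is largest on the initial interval. -/
lemma setLIntegral_le_rearr {h : ℝ → ℝ≥0∞} (hh : MeasPos h) (E : Set ℝ) :
    ∫⁻ x in E, h x ∂unitMeasure ≤ ∫⁻ x in Ioo 0 (unitMeasure E).toReal, rearr h x := by
  rw [lintegral_layer (hh.mono_measure Measure.restrict_le_self),
    lintegral_layer (measurable_rearr h).aemeasurable]
  refine lintegral_mono fun l => ?_
  have hm : MeasurableSet {t | ENNReal.ofReal l < rearr h t} := measurableSet_lt measurable_const
    (measurable_rearr h)
  have hle : (unitMeasure E).toReal ≤ 1 :=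
    ENNReal.toReal_le_of_le_ofReal zero_le_one (by simpa using prob_le_one)
  have h1 : {t | ENNReal.ofReal l < rearr h t} ∩ Ioo 0 (unitMeasure E).toReal =
      Ioo 0 (min (unitMeasure {x | ENNReal.ofReal l < h x}).toReal (unitMeasure E).toReal) := by
    rw [← max_self (0 : ℝ), ← Ioo_inter_Ioo, max_self, ← setOf_lt_rearr, inter_assoc,
      inter_eq_self_of_subset_right (Ioo_subset_Ioo_right hle)]
  rw [Measure.restrict_apply hm, h1, Real.volume_Ioo, sub_zero, ENNReal.ofReal_min,
    ENNReal.ofReal_toReal (measure_ne_top _ _), ENNReal.ofReal_toReal (measure_ne_top _ _)]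
  exact le_min (Measure.restrict_le_self _)
    ((measure_mono (subset_univ _)).trans (by rw [Measure.restrict_apply_univ]))

/-- The Hardy–Littlewood inequality. -/
lemma lintegral_mul_le_rearr {f h : ℝ → ℝ≥0∞} (hf : MeasPos f) (hh : MeasPos h) :
    ∫⁻ x, f x * h x ∂unitMeasure ≤ ∫⁻ x, rearr f x * rearr h x ∂unitMeasure := by
  have e : ∫⁻ x, f x * h x ∂unitMeasure = ∫⁻ x, hf.mk f x * h x ∂unitMeasure :=
    lintegral_congr_ae (by filter_upwards [hf.ae_eq_mk] with x hx; rw [hx])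
  rw [e, rearr_congr hf.ae_eq_mk, lintegral_mul_layer hf.measurable_mk hh,
    lintegral_mul_layer (measurable_rearr _) (measPos_rearr h)]
  refine lintegral_mono fun l => (setLIntegral_le_rearr hh _).trans ?_
  rw [setLIntegral_unitMeasure (measurableSet_lt measurable_const (measurable_rearr _)),
    setOf_lt_rearr]

lemma lintegral_tsub_rearr {f : ℝ → ℝ≥0∞} (hf : MeasPos f) (c : ℝ≥0∞) :
    ∫⁻ x, (rearr f x - c) ∂unitMeasure = ∫⁻ x, (f x - c) ∂unitMeasure := by
  rw [lintegral_layer ((measPos_rearr f).sub_const c), lintegral_layer (hf.sub_const c)]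
  simp_rw [lt_tsub_iff_right, unitMeasure_lt_rearr]

lemma normL1_rearr {f : ℝ → ℝ≥0∞} (hf : MeasPos f) : normL1 (rearr f) = normL1 f := by
  simpa [normL1] using lintegral_tsub_rearr hf 0

lemma lintegral_rearr_le {f : ℝ → ℝ≥0∞} (hf : MeasPos f) {t : ℝ} (ht : t ≤ 1) (c : ℝ≥0∞) :
    ∫⁻ s in Ioo 0 t, rearr f s ≤ ∫⁻ x, (f x - c) ∂unitMeasure + c * ENNReal.ofReal t := by
  calc ∫⁻ s in Ioo 0 t, rearr f s ≤ ∫⁻ s in Ioo 0 t, ((rearr f s - c) + c) :=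
        lintegral_mono fun s => le_tsub_add
    _ = (∫⁻ s in Ioo 0 t, (rearr f s - c)) + c * ENNReal.ofReal t := by
        rw [lintegral_add_right _ measurable_const, setLIntegral_const, Real.volume_Ioo, sub_zero]
    _ ≤ _ := by
        rw [← lintegral_tsub_rearr hf, unitMeasure]
        exact add_le_add_left (lintegral_mono_set (Ioo_subset_Ioo_right ht)) _

/-- The minimum over `c` of the bound in `lintegral_rearr_le` is attained at `c = f*(t)`. This
variational description of `∫₀ᵗ f*` yields its subadditivity in `f`. -/
lemma lintegral_rearr_eq {f : ℝ → ℝ≥0∞} (hf : MeasPos f) {t : ℝ} (h1 : t ≤ 1) :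
    ∫⁻ s in Ioo 0 t, rearr f s =
      ∫⁻ x, (f x - rearr f t) ∂unitMeasure + rearr f t * ENNReal.ofReal t := by
  refine le_antisymm (lintegral_rearr_le hf h1 _) ?_
  have e : ∫⁻ x, (f x - rearr f t) ∂unitMeasure = ∫⁻ s in Ioo 0 t, (rearr f s - rearr f t) := by
    rw [← lintegral_tsub_rearr hf, ← lintegral_indicator measurableSet_Ioo, unitMeasure,
      ← lintegral_indicator measurableSet_Ioo]
    refine lintegral_congr fun s => ?_
    simp only [indicator_apply, mem_Ioo]
    by_cases hs : s < t
    · by_cases hs0 : 0 < s <;> simp [hs, hs0, hs.trans_le h1]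
    · simp [hs, tsub_eq_zero_of_le (rearr_antitone f (not_lt.1 hs))]
  have e2 : rearr f t * ENNReal.ofReal t = ∫⁻ s in Ioo 0 t, rearr f t := by
    rw [setLIntegral_const, Real.volume_Ioo, sub_zero]
  rw [e, e2, ← lintegral_add_right _ measurable_const]
  refine setLIntegral_mono' measurableSet_Ioo fun s hs => ?_
  rw [tsub_add_cancel_of_le (rearr_antitone f hs.2.le)]

lemma lintegral_rearr_add_le {f g : ℝ → ℝ≥0∞} (hf : MeasPos f) (hg : MeasPos g) {t : ℝ}
    (h1 : t ≤ 1) :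
    ∫⁻ s in Ioo 0 t, rearr (fun x => f x + g x) s ≤
      ∫⁻ s in Ioo 0 t, (rearr f s + rearr g s) := by
  rw [lintegral_add_left (measurable_rearr f), lintegral_rearr_eq hf h1,
    lintegral_rearr_eq hg h1]
  calc _ ≤ ∫⁻ x, (f x + g x - (rearr f t + rearr g t)) ∂unitMeasure +
        (rearr f t + rearr g t) * ENNReal.ofReal t := lintegral_rearr_le (hf.add hg) h1 _
    _ ≤ ∫⁻ x, ((f x - rearr f t) + (g x - rearr g t)) ∂unitMeasure +
        (rearr f t + rearr g t) * ENNReal.ofReal t := by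
        gcongr with x
        exact add_tsub_add_le_tsub_add_tsub
    _ = _ := by
        rw [lintegral_add_left' (hf.sub_const _), add_mul]; ring

/-! ### Measure-preserving rearrangement and resonance -/

/-- The position of `x` when `(0, 1)` is ordered by decreasing values of `h`, ties being broken by
the order of the line: the measure of the set of points that come before `x`. -/
def rankMap (h : ℝ → ℝ≥0∞) (x : ℝ) : ℝ :=
  (unitMeasure {y | h x < h y ∨ (h y = h x ∧ y < x)}).toReal

lemma measurable_rankMap {h : ℝ → ℝ≥0∞} (hh : Measurable h) : Measurable (rankMap h) := by
  have hS : MeasurableSet {p : ℝ × ℝ | h p.1 < h p.2 ∨ (h p.2 = h p.1 ∧ p.2 < p.1)} :=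
    (measurableSet_lt (hh.comp measurable_fst) (hh.comp measurable_snd)).union
      ((measurableSet_eq_fun (hh.comp measurable_snd) (hh.comp measurable_fst)).inter
        (measurableSet_lt measurable_snd measurable_fst))
  exact (measurable_measure_prodMk_left (ν := unitMeasure) hS).ennreal_toReal

lemma ofReal_rankMap (h : ℝ → ℝ≥0∞) (x : ℝ) :
    ENNReal.ofReal (rankMap h x) = unitMeasure {y | h x < h y ∨ (h y = h x ∧ y < x)} :=
  ENNReal.ofReal_toReal (measure_ne_top _ _)

/-- Equality holds almost everywhere, but the inequality suffices for resonance. -/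
lemma rearr_rankMap_le (h : ℝ → ℝ≥0∞) (x : ℝ) : rearr h (rankMap h x) ≤ h x := by
  rw [rearr_le_iff, ofReal_rankMap]
  exact measure_mono fun y hy => Or.inl hy

lemma ofReal_le_measure_rearr_le {h : ℝ → ℝ≥0∞} (hh : Measurable h) {a : ℝ} (ha : a ≤ 1) :
    ENNReal.ofReal a ≤ unitMeasure {x | rearr h a ≤ h x} := by
  rcases eq_or_ne (rearr h a) 0 with h0 | h0
  · simpa [h0] using ha
  obtain ⟨u, hu, hur, hlim⟩ := exists_seq_strictMono_tendsto' (pos_iff_ne_zero.2 h0)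
  have hset : {x | rearr h a ≤ h x} = ⋂ n, {x | u n < h x} := by
    ext x
    simp only [mem_ofPred_eq, mem_iInter]
    exact ⟨fun hx n => (hur n).2.trans_le hx, fun hx => le_of_tendsto' hlim fun n => (hx n).le⟩
  have hanti : Antitone fun n => {x | u n < h x} := fun m n hmn x hx =>
    (hu.monotone hmn).trans_lt hx
  rw [hset, hanti.measure_iInter
    (fun n => (measurableSet_lt measurable_const hh).nullMeasurableSet)
    ⟨0, measure_ne_top _ _⟩]
  exact le_iInf fun n => ((lt_rearr_iff _ _ _).1 (hur n).2).le

/-- Splitting the level set of `h` at the height `h*(a)` by a point `b` gives a set of measure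
exactly `a` that is an initial segment for the order behind `rankMap`. -/
lemma exists_split {h : ℝ → ℝ≥0∞} (hh : Measurable h) {a : ℝ} (ha : a ≤ 1) :
    ∃ b : ℝ, unitMeasure {y | rearr h a < h y} + unitMeasure ({y | h y = rearr h a} ∩ Iio b) =
      ENNReal.ofReal a := by
  set k := rearr h a
  set m : ℝ → ℝ := fun b => (unitMeasure ({y | h y = k} ∩ Iio b)).toReal with hm
  have hlip : LipschitzWith 1 m := by
    refine LipschitzWith.of_le_add fun x y => ?_
    have : unitMeasure ({z | h z = k} ∩ Iio x) ≤
        unitMeasure ({z | h z = k} ∩ Iio y) + ENNReal.ofReal (dist x y) := by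
      calc _ ≤ unitMeasure (({z | h z = k} ∩ Iio y) ∪ Ico y x) := by
            refine measure_mono fun z hz => ?_
            rcases lt_or_ge z y with hzy | hzy
            · exact Or.inl ⟨hz.1, hzy⟩
            · exact Or.inr ⟨hzy, hz.2⟩
        _ ≤ _ := (measure_union_le _ _).trans ?_
      gcongr
      calc unitMeasure (Ico y x) ≤ volume (Ico y x) := Measure.restrict_le_self _
        _ = ENNReal.ofReal (x - y) := Real.volume_Ico
        _ ≤ _ := ENNReal.ofReal_le_ofReal (by rw [Real.dist_eq]; exact le_abs_self _)
    calc m x ≤ (unitMeasure ({z | h z = k} ∩ Iio y) + ENNReal.ofReal (dist x y)).toReal :=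
          ENNReal.toReal_mono (by simp) this
      _ = m y + dist x y := by
          rw [ENNReal.toReal_add (measure_ne_top _ _) ENNReal.ofReal_ne_top,
            ENNReal.toReal_ofReal dist_nonneg]
  have hle : unitMeasure {y | k < h y} ≤ ENNReal.ofReal a := (rearr_le_iff h k a).1 le_rfl
  have h0 : m 0 = 0 := by
    have : unitMeasure ({y | h y = k} ∩ Iio 0) = 0 :=
      measure_mono_null inter_subset_right (by simp [unitMeasure_Iio zero_le_one])
    simp [hm, this]
  have h1 : m 1 = (unitMeasure {y | h y = k}).toReal := by
    refine congrArg ENNReal.toReal (measure_congr ?_)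
    filter_upwards [ae_mem_unit] with x hx
    exact propext ⟨fun h => h.1, fun h => ⟨h, hx.2⟩⟩
  have hsum : ENNReal.ofReal a ≤ unitMeasure {y | k < h y} + unitMeasure {y | h y = k} := by
    refine (ofReal_le_measure_rearr_le hh ha).trans
      ((measure_mono fun x hx => ?_).trans (measure_union_le _ _))
    rcases lt_or_eq_of_le (show k ≤ h x from hx) with hx | hx
    · exact Or.inl hx
    · exact Or.inr hx.symm
  have hmem : (ENNReal.ofReal a - unitMeasure {y | k < h y}).toReal ∈ Icc (m 0) (m 1) := by
    rw [h0, h1]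
    exact ⟨ENNReal.toReal_nonneg, ENNReal.toReal_mono (measure_ne_top _ _)
      (tsub_le_iff_left.2 hsum)⟩
  obtain ⟨b, -, hb⟩ := intermediate_value_Icc zero_le_one hlip.continuous.continuousOn hmem
  refine ⟨b, ?_⟩
  rw [(ENNReal.toReal_eq_toReal_iff' (measure_ne_top _ _) (by simp)).1 hb,
    add_tsub_cancel_of_le hle]

lemma ofReal_le_measure_rankMap_le {h : ℝ → ℝ≥0∞} (hh : Measurable h) {a : ℝ} (ha : a ≤ 1) :
    ENNReal.ofReal a ≤ unitMeasure {x | ENNReal.ofReal (rankMap h x) ≤ ENNReal.ofReal a} := by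
  obtain ⟨b, hb⟩ := exists_split hh ha
  set k := rearr h a
  have hU : unitMeasure ({y | k < h y} ∪ {y | h y = k} ∩ Iio b) = ENNReal.ofReal a := by
    rw [measure_union _ ((measurableSet_eq_fun hh measurable_const).inter measurableSet_Iio), hb]
    rw [Set.disjoint_left]
    rintro x (hx : k < h x) ⟨hx' : h x = k, -⟩
    exact hx.ne' hx'
  refine hU.symm.le.trans (measure_mono ?_)
  rintro x (hx | ⟨hx, hxb⟩)
  · refine (ofReal_rankMap h x).trans_le (le_trans (measure_mono fun y hy => ?_)
      (le_self_add.trans hb.le))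
    rcases hy with hy | hy
    · exact lt_trans hx hy
    · exact lt_of_lt_of_eq hx hy.1.symm
  · refine (ofReal_rankMap h x).trans_le (le_trans (measure_mono ?_) hU.le)
    rintro y (hy | ⟨hy, hyx⟩)
    · exact Or.inl (lt_of_eq_of_lt hx.symm hy)
    · exact Or.inr ⟨hy.trans hx, lt_trans hyx hxb⟩

lemma measure_rankMap_lt_le {h : ℝ → ℝ≥0∞} (hh : Measurable h) {a : ℝ} (ha : a ≤ 1) :
    unitMeasure {x | ENNReal.ofReal (rankMap h x) < ENNReal.ofReal a} ≤ ENNReal.ofReal a := by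
  obtain ⟨b, hb⟩ := exists_split hh ha
  have hge := ofReal_le_measure_rearr_le hh ha
  set k := rearr h a
  refine le_trans (measure_mono ?_) ((measure_union_le _ _).trans hb.le)
  intro x (hx : ENNReal.ofReal (rankMap h x) < ENNReal.ofReal a)
  by_contra hc
  refine absurd hx (not_lt.2 ?_)
  rw [ofReal_rankMap]
  rcases lt_trichotomy (h x) k with hlt | heq | hgt
  · exact hge.trans (measure_mono fun y hy => Or.inl (lt_of_lt_of_le hlt hy))
  · have hxb : b ≤ x := not_lt.1 fun h => hc (Or.inr ⟨heq, h⟩)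
    rw [← hb, ← measure_union]
    · refine measure_mono ?_
      rintro y (hy | ⟨hy, hyb⟩)
      · exact Or.inl (lt_of_eq_of_lt heq hy)
      · exact Or.inr ⟨Eq.trans hy heq.symm, lt_of_lt_of_le hyb hxb⟩
    · rw [Set.disjoint_left]
      rintro x (hx : k < h x) ⟨hx' : h x = k, -⟩
      exact hx.ne' hx'
    · exact (measurableSet_eq_fun hh measurable_const).inter measurableSet_Iio
  · exact absurd (Or.inl hgt) hc

lemma measurePreserving_rankMap {h : ℝ → ℝ≥0∞} (hh : Measurable h) :
    MeasurePreserving (rankMap h) unitMeasure unitMeasure := by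
  refine ⟨measurable_rankMap hh, ?_⟩
  have := Measure.isProbabilityMeasure_map (μ := unitMeasure) (measurable_rankMap hh).aemeasurable
  refine Measure.ext_of_Iic _ _ fun a => ?_
  rw [Measure.map_apply (measurable_rankMap hh) measurableSet_Iic, measure_congr Iio_ae_eq_Iic.symm]
  have hnn : ∀ x, 0 ≤ rankMap h x := fun x => ENNReal.toReal_nonneg
  rcases lt_or_ge a 0 with ha | ha
  · rw [unitMeasure_Iio (ha.le.trans zero_le_one), ENNReal.ofReal_of_nonpos ha.le]
    convert measure_empty (μ := unitMeasure)
    exact eq_empty_of_forall_notMem fun x hx => absurd (ha.trans_le (hnn x)) (not_lt.2 hx)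
  rcases lt_or_ge a 1 with ha1 | ha1
  · rw [unitMeasure_Iio ha1.le]
    refine le_antisymm (ENNReal.le_of_forall_pos_le_add fun e he _ => ?_) ?_
    · rcases lt_or_ge (a + e) 1 with h1 | h1
      · calc unitMeasure (rankMap h ⁻¹' Iic a) ≤
              unitMeasure {x | ENNReal.ofReal (rankMap h x) < ENNReal.ofReal (a + e)} := by
              refine measure_mono fun x (hx : rankMap h x ≤ a) => ?_
              have he' : (0 : ℝ) < e := he
              exact (ENNReal.ofReal_lt_ofReal_iff (by linarith)).2 (by linarith)
          _ ≤ ENNReal.ofReal (a + e) := measure_rankMap_lt_le hh h1.le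
          _ = _ := by rw [ENNReal.ofReal_add ha e.coe_nonneg, ENNReal.ofReal_coe_nnreal]
      · calc unitMeasure (rankMap h ⁻¹' Iic a) ≤ 1 := prob_le_one
          _ ≤ ENNReal.ofReal (a + e) := by simpa using h1
          _ = _ := by rw [ENNReal.ofReal_add ha e.coe_nonneg, ENNReal.ofReal_coe_nnreal]
    · refine (ofReal_le_measure_rankMap_le hh ha1.le).trans (measure_mono fun x hx => ?_)
      exact (ENNReal.ofReal_le_ofReal_iff ha).1 hx
  · have h1 : unitMeasure (Iio a) = 1 := by
      refine le_antisymm prob_le_one ?_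
      calc (1 : ℝ≥0∞) = unitMeasure (Iio 1) := by simp [unitMeasure_Iio le_rfl]
        _ ≤ _ := measure_mono (Iio_subset_Iio ha1)
    rw [h1]
    convert measure_univ (μ := unitMeasure)
    refine eq_univ_of_forall fun x => ?_
    refine le_trans ?_ ha1
    exact ENNReal.toReal_le_of_le_ofReal zero_le_one (by simpa using prob_le_one)

variable {X : (ℝ → ℝ≥0∞) → ℝ≥0∞}

lemma le_assoc (f : ℝ → ℝ≥0∞) {g : ℝ → ℝ≥0∞} (hg : MeasPos g) (h1 : X g ≤ 1) :
    ∫⁻ t, f t * g t ∂unitMeasure ≤ assoc X f :=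
  le_iSup_of_le g (le_iSup_of_le hg (le_iSup_of_le h1 le_rfl))

lemma assoc_le {f : ℝ → ℝ≥0∞} {K : ℝ≥0∞}
    (h : ∀ g, MeasPos g → X g ≤ 1 → ∫⁻ t, f t * g t ∂unitMeasure ≤ K) : assoc X f ≤ K :=
  iSup_le fun g => iSup_le fun hg => iSup_le fun h1 => h g hg h1

lemma assoc_mono {f g : ℝ → ℝ≥0∞} (h : f ≤ᵐ[unitMeasure] g) : assoc X f ≤ assoc X g :=
  assoc_le fun u hu h1 => le_trans (lintegral_mono_ae (by
    filter_upwards [h] with t ht using mul_le_mul_left ht _)) (le_assoc g hu h1)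

lemma assoc_const_mul_le (c : ℝ≥0) (f : ℝ → ℝ≥0∞) :
    assoc X (fun t => (c : ℝ≥0∞) * f t) ≤ c * assoc X f :=
  assoc_le fun u hu h1 => by
    simp_rw [mul_assoc]
    rw [lintegral_const_mul' _ _ ENNReal.coe_ne_top]
    gcongr
    exact le_assoc f hu h1

/-- Resonance: the supremum defining the associate norm can be taken over rearrangements. -/
lemma lintegral_rearr_mul_le_assoc (hX : IsRINorm X) {u h : ℝ → ℝ≥0∞} (hu : MeasPos u)
    (hh : MeasPos h) (h1 : X u ≤ 1) :
    ∫⁻ t, rearr u t * rearr h t ∂unitMeasure ≤ assoc X h := by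
  obtain ⟨k, hk, hhk⟩ := hh
  have hs := measurePreserving_rankMap hk
  set w := rearr u ∘ rankMap k with hw
  have hwm : Measurable w := (measurable_rearr u).comp hs.measurable
  have hwr : rearr w = rearr u := by
    rw [← rearr_rearr u]
    refine rearr_eq_of_equimeasurable fun r => ?_
    exact hs.measure_preimage
      (measurableSet_lt measurable_const (measurable_rearr u)).nullMeasurableSet
  have hXw : X w ≤ 1 := by
    rw [hX.rearr_eq w hwm.aemeasurable, hwr, ← hX.rearr_eq u hu]; exact h1
  calc ∫⁻ t, rearr u t * rearr h t ∂unitMeasure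
      = ∫⁻ x, rearr u (rankMap k x) * rearr k (rankMap k x) ∂unitMeasure := by
        rw [rearr_congr hhk]
        exact (hs.lintegral_comp ((measurable_rearr u).mul (measurable_rearr k))).symm
    _ ≤ ∫⁻ x, h x * w x ∂unitMeasure := by
        refine lintegral_mono_ae ?_
        filter_upwards [hhk] with x hx
        rw [hx, mul_comm]
        exact mul_le_mul_left (rearr_rankMap_le k x) _
    _ ≤ assoc X h := le_assoc h hwm.aemeasurable hXw

/-- Hölder's inequality for the associate norm. -/
lemma lintegral_mul_le (hX : IsRINorm X) {f : ℝ → ℝ≥0∞} (hf : MeasPos f) (hfin : X f < ∞)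
    (k : ℝ → ℝ≥0∞) : ∫⁻ t, k t * f t ∂unitMeasure ≤ assoc X k * X f := by
  rcases eq_or_ne (X f) 0 with h0 | h0
  · have : ∫⁻ t, k t * f t ∂unitMeasure = ∫⁻ t, 0 ∂unitMeasure := by
      refine lintegral_congr_ae ?_
      filter_upwards [(hX.eq_zero_iff f hf).1 h0] with t ht
      simp [ht]
    simp [this]
  lift X f to ℝ≥0 using hfin.ne with c hc
  have hc0 : c ≠ 0 := by simpa using h0
  have hc0' : (c : ℝ≥0∞) ≠ 0 := by simpa using h0
  have h1 : X (fun t => ((c⁻¹ : ℝ≥0) : ℝ≥0∞) * f t) ≤ 1 := by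
    rw [hX.smul _ _ hf, ← hc, ← ENNReal.coe_mul, inv_mul_cancel₀ hc0, ENNReal.coe_one]
  have h2 := le_assoc k (hf.const_mul _) h1
  have h3 : ∫⁻ t, k t * (((c⁻¹ : ℝ≥0) : ℝ≥0∞) * f t) ∂unitMeasure =
      ((c⁻¹ : ℝ≥0) : ℝ≥0∞) * ∫⁻ t, k t * f t ∂unitMeasure := by
    rw [← lintegral_const_mul' _ _ ENNReal.coe_ne_top]
    refine lintegral_congr fun t => by ring
  rw [h3, ENNReal.coe_inv hc0] at h2
  rwa [mul_comm, ← div_eq_mul_inv, ENNReal.div_le_iff hc0' ENNReal.coe_ne_top] at h2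

lemma assoc_one_lt_top (hX : IsRINorm X) : assoc X (fun _ => 1) < ∞ := by
  obtain ⟨C, hC⟩ := hX.lintegral_le
  refine lt_of_le_of_lt (assoc_le (K := C) fun g hg h1 => ?_) ENNReal.coe_lt_top
  simp only [one_mul]
  exact (hC g hg).trans ((mul_le_mul_right h1 _).trans (mul_one _).le)

/-! ### The Lorentz–Luxemburg theorem -/

lemma iSup_min_natCast (a : ℝ≥0∞) : ⨆ n : ℕ, min a (n : ℝ≥0∞) = a := by
  have := inf_iSup_eq a (fun n : ℕ => (n : ℝ≥0∞))
  rw [ENNReal.iSup_natCast, inf_top_eq] at this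
  exact this.symm

lemma monotone_min_natCast (a : ℝ≥0∞) : Monotone fun n : ℕ => min a (n : ℝ≥0∞) :=
  fun _ _ h => min_le_min le_rfl (Nat.cast_le.2 h)

/-- Bounds for pairings may be checked on the truncations of one factor. -/
lemma lintegral_mul_le_of_forall_min {f g : ℝ → ℝ≥0∞} (hf : MeasPos f) (hg : MeasPos g)
    {K : ℝ≥0∞} (h : ∀ n : ℕ, ∫⁻ x, f x * min (g x) n ∂unitMeasure ≤ K) :
    ∫⁻ x, f x * g x ∂unitMeasure ≤ K := by
  have e : ∀ x, f x * g x = ⨆ n : ℕ, f x * min (g x) n := fun x => by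
    rw [← ENNReal.mul_iSup, iSup_min_natCast]
  simp_rw [e]
  rw [lintegral_iSup' (f := fun (n : ℕ) x => f x * min (g x) n)
    (fun n => hf.mul (hg.min aemeasurable_const))]
  · exact iSup_le h
  · exact ae_of_all _ fun x m n hmn => mul_le_mul_right (monotone_min_natCast _ hmn) _

/-- The real functions in `L²(0, 1)` whose absolute value lies in the ball of radius `c` of the
space with norm `X`. -/
def ballL2 (X : (ℝ → ℝ≥0∞) → ℝ≥0∞) (c : ℝ≥0) : Set (Lp ℝ 2 unitMeasure) :=
  {v | X (fun x => ‖v x‖ₑ) ≤ c}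

lemma measPos_enorm (v : Lp ℝ 2 unitMeasure) : MeasPos fun x => ‖v x‖ₑ :=
  (Lp.stronglyMeasurable v).measurable.enorm.aemeasurable

lemma convex_ballL2 (hX : IsRINorm X) (c : ℝ≥0) : Convex ℝ (ballL2 X c) := by
  intro u hu v hv a b ha hb hab
  have hum := measPos_enorm u
  have hvm := measPos_enorm v
  calc X (fun x => ‖(a • u + b • v : Lp ℝ 2 unitMeasure) x‖ₑ)
      ≤ X (fun x => (a.toNNReal : ℝ≥0∞) * ‖u x‖ₑ + (b.toNNReal : ℝ≥0∞) * ‖v x‖ₑ) := by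
        refine hX.mono _ _ (measPos_enorm _) ((hum.const_mul _).add (hvm.const_mul _)) ?_
        filter_upwards [Lp.coeFn_add (a • u) (b • v), Lp.coeFn_smul a u, Lp.coeFn_smul b v]
          with x h1 h2 h3
        rw [h1, Pi.add_apply, h2, h3, Pi.smul_apply, Pi.smul_apply]
        refine (enorm_add_le _ _).trans ?_
        rw [enorm_smul, enorm_smul, Real.enorm_of_nonneg ha, Real.enorm_of_nonneg hb]
        rfl
    _ ≤ a.toNNReal * X (fun x => ‖u x‖ₑ) + b.toNNReal * X (fun x => ‖v x‖ₑ) := by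
        refine (hX.add_le _ _ (hum.const_mul _) (hvm.const_mul _)).trans ?_
        rw [hX.smul _ _ hum, hX.smul _ _ hvm]
    _ ≤ a.toNNReal * c + b.toNNReal * c := by gcongr <;> assumption
    _ = c := by
        rw [← add_mul, ← ENNReal.coe_add, ← Real.toNNReal_add ha hb, hab]; simp

/-- Closedness comes from the Fatou property along an almost everywhere convergent subsequence. -/
lemma isClosed_ballL2 (hX : IsRINorm X) (c : ℝ≥0) : IsClosed (ballL2 X c) := by
  refine IsSeqClosed.isClosed fun v w hv hvw => ?_
  obtain ⟨φ, -, hφ⟩ := (tendstoInMeasure_of_tendsto_Lp hvw).exists_seq_tendsto_ae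
  have hm : ∀ n, MeasPos fun x => ⨅ i ≥ n, ‖v (φ i) x‖ₑ := fun n =>
    AEMeasurable.iInf fun i => AEMeasurable.iInf fun _ => measPos_enorm _
  have hlim := hX.fatou (fun n x => ⨅ i ≥ n, ‖v (φ i) x‖ₑ) (fun x => ‖w x‖ₑ) hm
    (measPos_enorm w) (by
      filter_upwards [hφ] with x hx
      have hmono : Monotone fun n => ⨅ i ≥ n, ‖v (φ i) x‖ₑ := fun m n hmn =>
        le_iInf₂ fun i hi => iInf₂_le i (hmn.trans hi)
      refine ⟨hmono, ?_⟩
      have h1 : Tendsto (fun n => ‖v (φ n) x‖ₑ) atTop (𝓝 ‖w x‖ₑ) := hx.enorm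
      rw [← h1.liminf_eq, liminf_eq_iSup_iInf_of_nat]
      exact tendsto_atTop_iSup hmono)
  refine le_of_tendsto' hlim fun n => le_trans (hX.mono _ _ (hm n) (measPos_enorm (v (φ n))) ?_)
    (hv (φ n))
  exact ae_of_all _ fun x => iInf₂_le n le_rfl

lemma memLp_toReal_of_le {g : ℝ → ℝ≥0∞} (hg : MeasPos g) {n : ℕ} (hn : ∀ x, g x ≤ n) :
    MemLp (fun x => (g x).toReal) 2 unitMeasure := by
  refine MemLp.of_bound hg.ennreal_toReal.aestronglyMeasurable n (ae_of_all _ fun x => ?_)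
  rw [Real.norm_of_nonneg ENNReal.toReal_nonneg]
  exact ENNReal.toReal_le_of_le_ofReal n.cast_nonneg (by simpa using hn x)

lemma integrable_mul_L2 (v w : Lp ℝ 2 unitMeasure) :
    Integrable (fun x => v x * w x) unitMeasure :=
  L2.integrable_inner (𝕜 := ℝ) w v

/-- A square-integrable function that separates a point from `ballL2 X c` belongs, after
normalization, to the unit ball of the associate space. -/
lemma assoc_enorm_le (hX : IsRINorm X) {c : ℝ≥0} {u : ℝ} (hu : 0 < u) {w : Lp ℝ 2 unitMeasure}
    (h : ∀ v ∈ ballL2 X c, ∫ x, v x * w x ∂unitMeasure ≤ u) :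
    assoc X (fun x => ENNReal.ofReal (1 / u) * (c * ‖w x‖ₑ)) ≤ 1 := by
  have hwm : Measurable w := (Lp.stronglyMeasurable w).measurable
  refine assoc_le fun g hg hg1 => lintegral_mul_le_of_forall_min
    ((hwm.enorm.const_mul _).const_mul _).aemeasurable hg fun n => ?_
  have hgn : MeasPos fun x => min (g x) (n : ℝ≥0∞) := hg.min aemeasurable_const
  have hr := memLp_toReal_of_le hgn (fun x => min_le_right _ _)
  have hgtop : ∀ x, min (g x) (n : ℝ≥0∞) ≠ ∞ := fun x =>
    ((min_le_right _ _).trans_lt (ENNReal.natCast_lt_top n)).ne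
  -- testing against `c · sign w · min(g, n)` turns `∫ v w` into `c ∫ |w| min(g, n)`
  have hv : MemLp (fun x => (c * (SignType.sign (w x) : ℝ)) * (min (g x) (n : ℝ≥0∞)).toReal) 2
      unitMeasure := by
    refine (hr.const_mul (c : ℝ)).mono ?_ (ae_of_all _ fun x => ?_)
    · refine (AEMeasurable.mul ?_ hgn.ennreal_toReal).aestronglyMeasurable
      refine (Measurable.const_mul ?_ _).aemeasurable
      have : (fun x => (SignType.sign (w x) : ℝ)) =
          fun x => if 0 < w x then (1 : ℝ) else if w x < 0 then -1 else 0 := by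
        funext x
        rcases lt_trichotomy (w x) 0 with h | h | h <;> simp [h, not_lt.2 h.le]
      rw [this]
      exact Measurable.ite (measurableSet_lt measurable_const hwm) measurable_const
        (Measurable.ite (measurableSet_lt hwm measurable_const) measurable_const
          measurable_const)
    · rw [norm_mul, norm_mul, norm_mul]
      gcongr
      have : ‖(SignType.sign (w x) : ℝ)‖ ≤ 1 := by
        rcases lt_trichotomy (w x) 0 with h | h | h <;> simp [h]
      exact mul_le_of_le_one_right (norm_nonneg _) this
  have hmem : hv.toLp _ ∈ ballL2 X c := by
    calc X (fun x => ‖hv.toLp _ x‖ₑ) ≤ X (fun x => (c : ℝ≥0∞) * g x) := by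
          refine hX.mono _ _ (measPos_enorm _) (hg.const_mul _) ?_
          filter_upwards [hv.coeFn_toLp] with x hx
          rw [hx, enorm_mul, enorm_mul, Real.enorm_of_nonneg ENNReal.toReal_nonneg,
            ENNReal.ofReal_toReal (hgtop x), Real.enorm_of_nonneg c.coe_nonneg,
            ENNReal.ofReal_coe_nnreal]
          have : ‖(SignType.sign (w x) : ℝ)‖ₑ ≤ 1 := by
            rcases lt_trichotomy (w x) 0 with h | h | h <;> simp [h]
          calc (c : ℝ≥0∞) * ‖(SignType.sign (w x) : ℝ)‖ₑ * min (g x) n ≤ c * 1 * g x := by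
                gcongr; exact min_le_left _ _
            _ = _ := by rw [mul_one]
      _ = c * X g := hX.smul _ _ hg
      _ ≤ c * 1 := by gcongr
      _ = c := mul_one _
  have hlt := h _ hmem
  have hval : ENNReal.ofReal (∫ x, hv.toLp _ x * w x ∂unitMeasure) =
      ∫⁻ x, c * ‖w x‖ₑ * min (g x) n ∂unitMeasure := by
    have hpt : ∀ᵐ x ∂unitMeasure, hv.toLp _ x * w x = c * |w x| * (min (g x) n).toReal := by
      filter_upwards [hv.coeFn_toLp] with x hx
      rw [hx, ← sign_mul_self]; ring
    rw [ofReal_integral_eq_lintegral_ofReal (integrable_mul_L2 (hv.toLp _) w)]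
    · refine lintegral_congr_ae ?_
      filter_upwards [hpt] with x hx
      rw [hx, ENNReal.ofReal_mul (by positivity), ENNReal.ofReal_mul (by positivity),
        ENNReal.ofReal_coe_nnreal, ENNReal.ofReal_toReal (hgtop x), Real.enorm_eq_ofReal_abs]
    · filter_upwards [hpt] with x hx
      rw [hx]; simp only [Pi.zero_apply]; positivity
  have e : ∫⁻ x, ENNReal.ofReal (1 / u) * (c * ‖w x‖ₑ) * min (g x) n ∂unitMeasure =
      ENNReal.ofReal (1 / u) * ENNReal.ofReal (∫ x, hv.toLp _ x * w x ∂unitMeasure) := by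
    rw [hval, ← lintegral_const_mul' _ _ ENNReal.ofReal_ne_top]
    simp only [mul_assoc]
  rw [e, ← ENNReal.ofReal_mul (by positivity), ← ENNReal.ofReal_one]
  refine ENNReal.ofReal_le_ofReal ?_
  rw [one_div, inv_mul_le_iff₀ hu]
  linarith

lemma le_of_forall_assoc_le_one_of_bounded (hX : IsRINorm X) {F : ℝ → ℝ≥0∞} (hF : MeasPos F)
    {N : ℕ} (hN : ∀ x, F x ≤ N) {K : ℝ≥0∞}
    (h : ∀ h : ℝ → ℝ≥0∞, Measurable h → (∃ n : ℕ, ∀ x, h x ≤ n) → assoc X h ≤ 1 →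
      ∫⁻ x, F x * h x ∂unitMeasure ≤ K) : X F ≤ K := by
  by_contra! hlt
  obtain ⟨c, hKc, hcX⟩ := ENNReal.lt_iff_exists_nnreal_btwn.1 hlt
  have hFr := memLp_toReal_of_le hF hN
  set v₀ : Lp ℝ 2 unitMeasure := hFr.toLp _ with hv₀
  have hv₀F : ∀ᵐ x ∂unitMeasure, v₀ x = (F x).toReal := hFr.coeFn_toLp
  have hx₀ : v₀ ∉ ballL2 X c := by
    have : (fun x => ‖v₀ x‖ₑ) =ᵐ[unitMeasure] F := by
      filter_upwards [hv₀F] with x hx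
      rw [hx, Real.enorm_of_nonneg ENNReal.toReal_nonneg,
        ENNReal.ofReal_toReal ((hN x).trans_lt (ENNReal.natCast_lt_top N)).ne]
    intro hmem
    exact absurd (hcX.trans_le (hX.mono _ _ hF (measPos_enorm _) this.symm.le)) (not_lt.2 hmem)
  obtain ⟨f, u, hfB, hfu⟩ :=
    geometric_hahn_banach_closed_point (convex_ballL2 hX c) (isClosed_ballL2 hX c) hx₀
  set w := (InnerProductSpace.toDual ℝ (Lp ℝ 2 unitMeasure)).symm f with hw
  have hfw : ∀ v : Lp ℝ 2 unitMeasure, f v = ∫ x, v x * w x ∂unitMeasure := fun v => by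
    rw [← InnerProductSpace.toDual_symm_apply, ← hw, L2.inner_def]
    rfl
  have hwm : Measurable w := (Lp.stronglyMeasurable w).measurable
  have hu : 0 < u := by
    have h0 : (0 : Lp ℝ 2 unitMeasure) ∈ ballL2 X c := by
      have : X (fun x => ‖(0 : Lp ℝ 2 unitMeasure) x‖ₑ) = 0 := by
        rw [hX.eq_zero_iff _ (measPos_enorm _)]
        exact ae_of_all _ fun x => by simp
      exact this.trans_le (zero_le)
    simpa using hfB 0 h0
  -- `|w|` rescaled to lie in the unit ball of the associate space
  set k : ℝ → ℝ≥0∞ := fun x => ENNReal.ofReal (1 / u) * (c * ‖w x‖ₑ) with hk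
  have hkm : Measurable k := (hwm.enorm.const_mul _).const_mul _
  have hk1 : assoc X k ≤ 1 :=
    assoc_enorm_le hX hu fun v hv => (hfw v).symm.le.trans (hfB v hv).le
  have hFk : ∫⁻ x, F x * k x ∂unitMeasure ≤ K :=
    lintegral_mul_le_of_forall_min hF hkm.aemeasurable fun n =>
      h _ (hkm.min measurable_const) ⟨n, fun x => min_le_right _ _⟩
        ((assoc_mono (ae_of_all _ fun x => min_le_left _ _)).trans hk1)
  have hge : (c : ℝ≥0∞) ≤ ∫⁻ x, F x * k x ∂unitMeasure := by
    have h1 : ENNReal.ofReal (f v₀) ≤ ∫⁻ x, F x * ‖w x‖ₑ ∂unitMeasure := by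
      calc ENNReal.ofReal (f v₀) ≤ ‖f v₀‖ₑ := by
            rw [Real.enorm_eq_ofReal_abs]; exact ENNReal.ofReal_le_ofReal (le_abs_self _)
        _ ≤ ∫⁻ x, ‖v₀ x * w x‖ₑ ∂unitMeasure := by
            rw [hfw]; exact enorm_integral_le_lintegral_enorm _
        _ = _ := by
            refine lintegral_congr_ae ?_
            filter_upwards [hv₀F] with x hx
            rw [hx, enorm_mul, Real.enorm_of_nonneg ENNReal.toReal_nonneg,
              ENNReal.ofReal_toReal ((hN x).trans_lt (ENNReal.natCast_lt_top N)).ne]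
    have e : ∫⁻ x, F x * k x ∂unitMeasure =
        ENNReal.ofReal (1 / u) * c * ∫⁻ x, F x * ‖w x‖ₑ ∂unitMeasure := by
      rw [← lintegral_const_mul' _ _ (by finiteness)]
      refine lintegral_congr fun x => ?_
      simp only [hk]; ring
    rw [e]
    calc (c : ℝ≥0∞) = ENNReal.ofReal (1 / u) * c * ENNReal.ofReal u := by
          rw [mul_right_comm, ← ENNReal.ofReal_mul (by positivity), one_div,
            inv_mul_cancel₀ hu.ne']; simp
      _ ≤ _ := by gcongr; exact (ENNReal.ofReal_le_ofReal hfu.le).trans h1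
  exact absurd (hKc.trans_le (hge.trans hFk)) (lt_irrefl _)

/-- The Lorentz–Luxemburg theorem: the norm of `F` is determined by its pairings with the bounded
functions in the unit ball of the associate space. -/
lemma le_of_forall_assoc_le_one (hX : IsRINorm X) {F : ℝ → ℝ≥0∞} (hF : MeasPos F) {K : ℝ≥0∞}
    (h : ∀ h : ℝ → ℝ≥0∞, Measurable h → (∃ n : ℕ, ∀ x, h x ≤ n) → assoc X h ≤ 1 →
      ∫⁻ x, F x * h x ∂unitMeasure ≤ K) : X F ≤ K := by
  have hm : ∀ n : ℕ, MeasPos fun x => min (F x) (n : ℝ≥0∞) := fun n => hF.min aemeasurable_const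
  refine le_of_tendsto' (hX.fatou _ F hm hF (ae_of_all _ fun x => ?_)) fun n =>
    le_of_forall_assoc_le_one_of_bounded hX (hm n) (fun x => min_le_right _ _)
      fun k hk hkb hk1 => le_trans (lintegral_mono fun x => ?_) (h k hk hkb hk1)
  · refine ⟨monotone_min_natCast _, ?_⟩
    conv in 𝓝 _ => rw [← iSup_min_natCast (F x)]
    exact tendsto_atTop_iSup (monotone_min_natCast _)
  · exact mul_le_mul_left (min_le_left _ _) _

/-! ### The Hardy-type operator and its dual -/

lemma lintegral_Ioo_right {t : ℝ} (ht : 0 ≤ t) (b : ℝ → ℝ≥0∞) :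
    ∫⁻ s in Ioo t 1, b s = ∫⁻ s, (Ioi t).indicator b s ∂unitMeasure := by
  rw [lintegral_indicator measurableSet_Ioi, setLIntegral_unitMeasure measurableSet_Ioi]
  congr 2
  ext s
  simp only [mem_Ioo, mem_inter_iff, mem_Ioi]
  exact ⟨fun h => ⟨h.1, ht.trans_lt h.1, h.2⟩, fun h => ⟨h.1, h.2.2⟩⟩

lemma lintegral_Ioo_left {t : ℝ} (ht : t ≤ 1) (b : ℝ → ℝ≥0∞) :
    ∫⁻ s in Ioo 0 t, b s = ∫⁻ s, (Iio t).indicator b s ∂unitMeasure := by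
  rw [lintegral_indicator measurableSet_Iio, setLIntegral_unitMeasure measurableSet_Iio]
  congr 2
  ext s
  simp only [mem_Ioo, mem_inter_iff, mem_Iio]
  exact ⟨fun h => ⟨h.2, h.1, h.2.trans_le ht⟩, fun h => ⟨h.2.1, h.1⟩⟩

/-- Tonelli's theorem on the triangle `0 < t < s < 1`. -/
lemma lintegral_triangle {a b : ℝ → ℝ≥0∞} (ha : MeasPos a) (hb : MeasPos b) :
    ∫⁻ t, a t * (∫⁻ s in Ioo t 1, b s) ∂unitMeasure =
      ∫⁻ s, b s * (∫⁻ t in Ioo 0 s, a t) ∂unitMeasure := by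
  have hS : MeasurableSet {p : ℝ × ℝ | p.1 < p.2} := measurableSet_lt measurable_fst measurable_snd
  set k : ℝ → ℝ → ℝ≥0∞ := fun t s =>
    {p : ℝ × ℝ | p.1 < p.2}.indicator (fun p => a p.1 * b p.2) (t, s) with hk
  have h1 : ∫⁻ t, a t * (∫⁻ s in Ioo t 1, b s) ∂unitMeasure =
      ∫⁻ t, ∫⁻ s, k t s ∂unitMeasure ∂unitMeasure := by
    refine lintegral_congr_ae ?_
    filter_upwards [ae_mem_unit] with t ht
    rw [lintegral_Ioo_right ht.1.le, ← lintegral_const_mul'' _ (hb.indicator measurableSet_Ioi)]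
    refine lintegral_congr fun s => ?_
    by_cases h : t < s <;> simp [hk, indicator_apply, h]
  have h2 : ∫⁻ s, b s * (∫⁻ t in Ioo 0 s, a t) ∂unitMeasure =
      ∫⁻ s, ∫⁻ t, k t s ∂unitMeasure ∂unitMeasure := by
    refine lintegral_congr_ae ?_
    filter_upwards [ae_mem_unit] with s hs
    rw [lintegral_Ioo_left hs.2.le, ← lintegral_const_mul'' _ (ha.indicator measurableSet_Iio)]
    refine lintegral_congr fun t => ?_
    by_cases h : t < s <;> simp [hk, indicator_apply, h, mul_comm]
  rw [h1, h2, lintegral_lintegral_swap]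
  exact (ha.comp_fst.mul hb.comp_snd).indicator hS

namespace ClassQ

variable {I : ℝ → ℝ}

lemma pos (hI : ClassQ I) {t : ℝ} (ht : t ∈ Ioo (0 : ℝ) 1) : 0 < I t := (hI.bijOn.mapsTo ht).1

lemma lt_one (hI : ClassQ I) {t : ℝ} (ht : t ∈ Ioo (0 : ℝ) 1) : I t < 1 := (hI.bijOn.mapsTo ht).2

lemma aemeasurable (hI : ClassQ I) : AEMeasurable I unitMeasure :=
  aemeasurable_restrict_of_monotoneOn measurableSet_Ioo hI.monotoneOn

lemma self_le (hI : ClassQ I) {t : ℝ} (ht : t ∈ Ioo (0 : ℝ) 1) : t ≤ I t := by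
  by_contra! hlt
  have hq : I t / t ∈ Ioo (0 : ℝ) 1 := ⟨div_pos (hI.pos ht) ht.1, (div_lt_one ht.1).2 hlt⟩
  -- the value `I t / t` would not be attained
  obtain ⟨s, hs, hsq⟩ := hI.bijOn.surjOn hq
  rcases le_total s t with hst | hst
  · have h1 := hI.monotoneOn hs ht hst
    rw [hsq] at h1
    have : I t < I t / t := by
      rw [lt_div_iff₀ ht.1]; nlinarith [hI.pos ht, ht.2]
    linarith
  · have h1 : I s / s ≤ I t / t := hI.antitoneOn_div ht hs hst
    rw [hsq, div_le_iff₀ hs.1] at h1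
    nlinarith [hs.2, hq.1]

lemma ofReal_pos (hI : ClassQ I) {t : ℝ} (ht : t ∈ Ioo (0 : ℝ) 1) : ENNReal.ofReal (I t) ≠ 0 := by
  simpa using hI.pos ht

end ClassQ

/-- The operator `g ↦ (1 / I(t)) ∫₀ᵗ g`, dual to `opH I`. -/
def opHDual (I : ℝ → ℝ) (g : ℝ → ℝ≥0∞) (t : ℝ) : ℝ≥0∞ :=
  (∫⁻ s in Ioo 0 t, g s) / ENNReal.ofReal (I t)

lemma measurable_primitive (g : ℝ → ℝ≥0∞) : Measurable fun t => ∫⁻ s in Ioo 0 t, g s :=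
  Monotone.measurable fun _ _ h => lintegral_mono_set (Ioo_subset_Ioo_right h)

variable {I : ℝ → ℝ}

lemma opH_antitone (I : ℝ → ℝ) (f : ℝ → ℝ≥0∞) : Antitone (opH I f) := fun _ _ h =>
  lintegral_mono_set (Ioo_subset_Ioo_left h)

lemma lintegral_opH_mul (hI : ClassQ I) {f g : ℝ → ℝ≥0∞} (hf : MeasPos f) (hg : MeasPos g) :
    ∫⁻ t, opH I f t * g t ∂unitMeasure = ∫⁻ t, opHDual I g t * f t ∂unitMeasure := by
  have h := lintegral_triangle hg (hf.div hI.aemeasurable.ennreal_ofReal)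
  simp only [opH, opHDual, mul_comm _ (g _)]
  refine h.trans (lintegral_congr fun s => ?_)
  simp only [div_eq_mul_inv, Pi.div_apply]; ring

/-! ### The optimal target norm -/

/-- The norm of the optimal target space for `X` under `opH I`, obtained by duality: the supremum
of the pairings of `f*` with the nonincreasing functions that the dual operator maps into the
unit ball of the associate space of `X`. -/
def targetNorm (I : ℝ → ℝ) (X : (ℝ → ℝ≥0∞) → ℝ≥0∞) (f : ℝ → ℝ≥0∞) : ℝ≥0∞ :=
  ⨆ (g : ℝ → ℝ≥0∞) (_ : Antitone g) (_ : assoc X (opHDual I g) ≤ 1),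
    ∫⁻ t, rearr f t * g t ∂unitMeasure

lemma le_targetNorm (f : ℝ → ℝ≥0∞) {g : ℝ → ℝ≥0∞} (hg : Antitone g)
    (h1 : assoc X (opHDual I g) ≤ 1) :
    ∫⁻ t, rearr f t * g t ∂unitMeasure ≤ targetNorm I X f :=
  le_iSup_of_le g (le_iSup_of_le hg (le_iSup_of_le h1 le_rfl))

lemma targetNorm_le {f : ℝ → ℝ≥0∞} {K : ℝ≥0∞}
    (h : ∀ g, Antitone g → assoc X (opHDual I g) ≤ 1 →
      ∫⁻ t, rearr f t * g t ∂unitMeasure ≤ K) : targetNorm I X f ≤ K :=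
  iSup_le fun g => iSup_le fun hg => iSup_le fun h1 => h g hg h1

lemma targetNorm_mono {f g : ℝ → ℝ≥0∞} (h : f ≤ᵐ[unitMeasure] g) :
    targetNorm I X f ≤ targetNorm I X g :=
  targetNorm_le fun _ hu h1 => le_trans (lintegral_mono fun t =>
    mul_le_mul_left (rearr_mono h t) _) (le_targetNorm g hu h1)

lemma setLIntegral_Ioo_const (c : ℝ≥0) (t : ℝ) :
    ∫⁻ _ in Ioo 0 t, (c : ℝ≥0∞) = c * ENNReal.ofReal t := by
  simp

lemma exists_normL1_le_targetNorm (hI : ClassQ I) (hX : IsRINorm X) :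
    ∃ C : ℝ≥0, ∀ f, MeasPos f → normL1 f ≤ C * targetNorm I X f := by
  obtain ⟨K, hK⟩ := ENNReal.lt_iff_exists_coe.1 (assoc_one_lt_top hX)
  have hK1 : (K + 1 : ℝ≥0) ≠ 0 := by positivity
  refine ⟨K + 1, fun f hf => ?_⟩
  have h1 : assoc X (opHDual I fun _ => (((K + 1)⁻¹ : ℝ≥0) : ℝ≥0∞)) ≤ 1 := by
    calc _ ≤ assoc X (fun t => (((K + 1)⁻¹ : ℝ≥0) : ℝ≥0∞) * 1) := by
          refine assoc_mono ?_
          filter_upwards [ae_mem_unit] with t ht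
          rw [opHDual, setLIntegral_Ioo_const, mul_div_assoc]
          gcongr
          exact ENNReal.div_le_of_le_mul
            (by rw [one_mul]; exact ENNReal.ofReal_le_ofReal (hI.self_le ht))
      _ ≤ ((K + 1)⁻¹ : ℝ≥0) * assoc X (fun _ => 1) := assoc_const_mul_le _ _
      _ ≤ 1 := by
          rw [hK.1, ← ENNReal.coe_mul, ← ENNReal.coe_one, ENNReal.coe_le_coe,
            inv_mul_le_iff₀ (by positivity)]
          simp
  have h2 := le_targetNorm (I := I) (X := X) f (antitone_const) h1
  rw [lintegral_mul_const' _ _ ENNReal.coe_ne_top] at h2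
  rw [← normL1_rearr hf]
  calc normL1 (rearr f) = ((K + 1 : ℝ≥0) : ℝ≥0∞) *
        (normL1 (rearr f) * ((K + 1)⁻¹ : ℝ≥0)) := by
        rw [mul_left_comm, ← ENNReal.coe_mul, mul_inv_cancel₀ hK1, ENNReal.coe_one, mul_one]
    _ ≤ _ := mul_le_mul_right h2 _

/-- The weights admissible for `targetNorm` are bounded in `L¹`, so that constants have finite
norm. -/
lemma normL1_le_of_assoc_le_one (hI : ClassQ I) (hX : IsRINorm X) {g : ℝ → ℝ≥0∞}
    (hg : Antitone g) (h1 : assoc X (opHDual I g) ≤ 1) : normL1 g ≤ 4 * X fun _ => 1 := by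
  have hX1 : ∫⁻ t, opHDual I g t ∂unitMeasure ≤ X fun _ => 1 := by
    have := lintegral_mul_le hX (f := fun _ => 1) aemeasurable_const hX.one_lt_top (opHDual I g)
    simp only [mul_one] at this
    exact this.trans ((mul_le_mul_left h1 _).trans (one_mul _).le)
  have e2 : ENNReal.ofReal (1 / 2) * 2 = 1 := by
    rw [ENNReal.ofReal_div_of_pos two_pos]; simp [ENNReal.inv_mul_cancel]
  -- on `(1/2, 1)` the dual operator dominates `∫₀^{1/2} g` because `I ≤ 1`
  have h2 : (∫⁻ s in Ioo 0 (1 / 2), g s) * ENNReal.ofReal (1 / 2) ≤ X fun _ => 1 := by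
    calc (∫⁻ s in Ioo 0 (1 / 2), g s) * ENNReal.ofReal (1 / 2)
        = ∫⁻ t in Ioo (1 / 2 : ℝ) 1, (∫⁻ s in Ioo 0 (1 / 2), g s) := by
          rw [setLIntegral_const, Real.volume_Ioo]; norm_num
      _ ≤ ∫⁻ t in Ioo (1 / 2 : ℝ) 1, opHDual I g t := by
          refine setLIntegral_mono' measurableSet_Ioo fun t ht => ?_
          have ht' : t ∈ Ioo (0 : ℝ) 1 := ⟨by linarith [ht.1], ht.2⟩
          rw [opHDual, ENNReal.le_div_iff_mul_le (Or.inl (hI.ofReal_pos ht'))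
            (Or.inl ENNReal.ofReal_ne_top)]
          calc _ ≤ (∫⁻ s in Ioo 0 t, g s) * 1 :=
                mul_le_mul' (lintegral_mono_set (Ioo_subset_Ioo_right ht.1.le))
                  (by simpa using (hI.lt_one ht').le)
            _ = _ := mul_one _
      _ ≤ ∫⁻ t in Ioo (0 : ℝ) 1, opHDual I g t :=
          lintegral_mono_set (Ioo_subset_Ioo_left (by norm_num))
      _ ≤ _ := hX1
  have h3 : ∫⁻ s in Ico (1 / 2 : ℝ) 1, g s ≤ ∫⁻ s in Ioo 0 (1 / 2), g s := by
    calc ∫⁻ s in Ico (1 / 2 : ℝ) 1, g s ≤ ∫⁻ s in Ico (1 / 2 : ℝ) 1, g (1 / 2) :=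
          setLIntegral_mono' measurableSet_Ico fun s hs => hg hs.1
      _ = ∫⁻ s in Ioo 0 (1 / 2 : ℝ), g (1 / 2) := by
          rw [setLIntegral_const, setLIntegral_const, Real.volume_Ico, Real.volume_Ioo]; norm_num
      _ ≤ _ := setLIntegral_mono' measurableSet_Ioo fun s hs => hg hs.2.le
  calc normL1 g ≤ ∫⁻ s in Ioo 0 (1 / 2) ∪ Ico (1 / 2 : ℝ) 1, g s := by
        refine lintegral_mono_set fun x hx => ?_
        rcases lt_or_ge x (1 / 2) with h | h
        · exact Or.inl ⟨hx.1, h⟩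
        · exact Or.inr ⟨h, hx.2⟩
    _ ≤ (∫⁻ s in Ioo 0 (1 / 2), g s) + ∫⁻ s in Ico (1 / 2 : ℝ) 1, g s := lintegral_union_le _ _ _
    _ ≤ (∫⁻ s in Ioo 0 (1 / 2), g s) + ∫⁻ s in Ioo 0 (1 / 2), g s := by gcongr
    _ = 4 * ((∫⁻ s in Ioo 0 (1 / 2), g s) * ENNReal.ofReal (1 / 2)) := by
        have : (4 : ℝ≥0∞) = 2 * 2 := by norm_num
        rw [this, mul_comm _ (ENNReal.ofReal (1 / 2)), ← mul_assoc, mul_assoc 2 2,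
          mul_comm 2 (ENNReal.ofReal (1 / 2)), e2, mul_one, two_mul]
    _ ≤ _ := by gcongr

lemma isRINorm_targetNorm (hI : ClassQ I) (hX : IsRINorm X) : IsRINorm (targetNorm I X) where
  eq_zero_iff f hf := by
    constructor
    · intro h
      obtain ⟨C, hC⟩ := exists_normL1_le_targetNorm hI hX
      have := hC f hf
      rw [h, mul_zero, nonpos_iff_eq_zero] at this
      exact (lintegral_eq_zero_iff' hf).1 this
    · intro h
      refine le_antisymm (targetNorm_le fun g _ _ => ?_) zero_le
      have h0 : ∀ t, rearr f t = 0 := fun t => by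
        rw [rearr_congr h]
        exact le_antisymm ((rearr_le_iff _ _ _).2 (by simp)) zero_le
      simp [h0]
  smul a f _ := by
    simp only [targetNorm, ENNReal.mul_iSup, rearr_const_mul, mul_assoc]
    simp_rw [lintegral_const_mul' _ _ (ENNReal.coe_ne_top (r := a))]
  add_le f g hf hg := targetNorm_le fun u hu h1 => by
    calc _ ≤ ∫⁻ t, (rearr f t + rearr g t) * u t ∂unitMeasure :=
          lintegral_mul_le_of_antitone (measPos_rearr _) ((measPos_rearr f).add (measPos_rearr g))
            hu fun t ht => lintegral_rearr_add_le hf hg ht.2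
      _ = ∫⁻ t, rearr f t * u t ∂unitMeasure + ∫⁻ t, rearr g t * u t ∂unitMeasure := by
          simp_rw [add_mul]
          exact lintegral_add_left ((measurable_rearr f).mul hu.measurable) _
      _ ≤ _ := add_le_add (le_targetNorm f hu h1) (le_targetNorm g hu h1)
  mono f g _ _ h := targetNorm_mono h
  fatou f g _ _ h := by
    have hmono : Monotone fun n => targetNorm I X (f n) := fun m n hmn => targetNorm_mono (by
      filter_upwards [h] with x hx using hx.1 hmn)
    have e : targetNorm I X g = ⨆ n, targetNorm I X (f n) := by
      refine le_antisymm (targetNorm_le fun u hu h1 => ?_) (iSup_le fun n => targetNorm_mono ?_)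
      · simp_rw [rearr_eq_iSup h, ENNReal.iSup_mul]
        rw [lintegral_iSup (f := fun n t => rearr (f n) t * u t)
          (fun n => (measurable_rearr _).mul hu.measurable)]
        · exact iSup_mono fun n => le_targetNorm _ hu h1
        · exact fun m n hmn t => mul_le_mul_left (rearr_mono (by
            filter_upwards [h] with x hx using hx.1 hmn) t) _
      · filter_upwards [h] with x hx using hx.1.ge_of_tendsto hx.2 n
    rw [e]
    exact tendsto_atTop_iSup hmono
  one_lt_top := by
    refine lt_of_le_of_lt (targetNorm_le (K := 4 * X fun _ => 1) fun g hg h1 => ?_)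
      (ENNReal.mul_lt_top (by norm_num) hX.one_lt_top)
    refine (lintegral_mono fun t => ?_).trans (normL1_le_of_assoc_le_one hI hX hg h1)
    have : rearr (fun _ => 1) t ≤ 1 := (rearr_le_iff _ _ _).2 (by simp)
    exact (mul_le_mul_left this _).trans (one_mul _).le
  lintegral_le := exists_normL1_le_targetNorm hI hX
  rearr_eq f _ := by simp only [targetNorm, rearr_rearr]

lemma isBoundedOp_targetNorm (hI : ClassQ I) (hX : IsRINorm X) :
    IsBoundedOp (opH I) X (targetNorm I X) := by
  refine ⟨1, fun f hf hfin => targetNorm_le fun g hg h1 => ?_⟩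
  calc ∫⁻ t, rearr (opH I f) t * g t ∂unitMeasure
      ≤ ∫⁻ t, opH I f t * g t ∂unitMeasure := lintegral_mono fun t =>
        mul_le_mul_left (rearr_le_of_antitone (opH_antitone I f) t) _
    _ = ∫⁻ t, opHDual I g t * f t ∂unitMeasure :=
        lintegral_opH_mul hI hf hg.measurable.aemeasurable
    _ ≤ assoc X (opHDual I g) * X f := lintegral_mul_le hX hf hfin _
    _ ≤ _ := by gcongr; simpa using h1

/-! ### Recovering a function from its oscillation -/

/-- The weighted oscillation `(I(t) / t) (f**(t) - f*(t))`. -/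
def oscillation (I : ℝ → ℝ) (f : ℝ → ℝ≥0∞) (t : ℝ) : ℝ≥0∞ :=
  ENNReal.ofReal (I t / t) * (maxRearr f t - rearr f t)

lemma measurable_maxRearr (f : ℝ → ℝ≥0∞) : Measurable (maxRearr f) :=
  (measurable_primitive _).div ENNReal.measurable_ofReal

lemma measPos_oscillation (hI : ClassQ I) (f : ℝ → ℝ≥0∞) : MeasPos (oscillation I f) :=
  (hI.aemeasurable.div aemeasurable_id).ennreal_ofReal.mul
    ((measurable_maxRearr f).sub (measurable_rearr f)).aemeasurable

lemma rearr_le_maxRearr (f : ℝ → ℝ≥0∞) {t : ℝ} (ht : 0 < t) : rearr f t ≤ maxRearr f t := by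
  rw [maxRearr, ENNReal.le_div_iff_mul_le (by simp [ht]) (by simp)]
  calc rearr f t * ENNReal.ofReal t = ∫⁻ s in Ioo 0 t, rearr f t := by simp
    _ ≤ _ := setLIntegral_mono' measurableSet_Ioo fun s hs => rearr_antitone f hs.2.le

lemma lintegral_one_div_sq {a : ℝ} (h0 : 0 < a) (h1 : a ≤ 1) :
    ∫⁻ s in Ioo a 1, ENNReal.ofReal (1 / s ^ 2) = ENNReal.ofReal (1 / a - 1) := by
  have hderiv : ∀ s ∈ uIcc a 1, HasDerivAt (fun s : ℝ => -s⁻¹) (1 / s ^ 2) s := fun s hs => by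
    rw [uIcc_of_le h1] at hs
    have := (hasDerivAt_inv (h0.trans_le hs.1).ne').neg
    rw [neg_neg, ← one_div] at this
    exact this
  have hcont : ContinuousOn (fun s : ℝ => 1 / s ^ 2) (uIcc a 1) := fun s hs => by
    rw [uIcc_of_le h1] at hs
    exact (continuousAt_const.div (continuousAt_id.pow 2)
      (pow_ne_zero _ (h0.trans_le hs.1).ne')).continuousWithinAt
  have hint := hcont.intervalIntegrable (μ := volume)
  have h := intervalIntegral.integral_eq_sub_of_hasDerivAt hderiv hint
  rw [intervalIntegral.integral_of_le h1] at h
  rw [restrict_Ioo_eq_restrict_Ioc, ← ofReal_integral_eq_lintegral_ofReal, h]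
  · congr 1; simp; ring
  · exact (intervalIntegrable_iff_integrableOn_Ioc_of_le h1).1 hint
  · exact ae_of_all _ fun s => by positivity

/-- The function `f**` is recovered from its derivative `-(f** - f*) / t`, integrated back from
the end point `1`. -/
lemma maxRearr_le_normL1_add_opH (hI : ClassQ I) {f : ℝ → ℝ≥0∞} (hf : MeasPos f)
    (hfin : normL1 f ≠ ∞) {t : ℝ} (ht : t ∈ Ioo (0 : ℝ) 1) :
    maxRearr f t ≤ normL1 f + opH I (oscillation I f) t := by
  set b : ℝ → ℝ≥0∞ := (Ioi t).indicator fun s => ENNReal.ofReal (1 / s ^ 2) with hb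
  have hbm : Measurable b := Measurable.indicator (by fun_prop) measurableSet_Ioi
  set A := ∫⁻ s in Ioo t 1, ENNReal.ofReal (1 / s) * rearr f s with hA
  have hAfin : A ≠ ∞ := by
    refine ne_top_of_le_ne_top (ENNReal.mul_ne_top (ENNReal.ofReal_ne_top (r := 1 / t)) hfin) ?_
    rw [← normL1_rearr hf, normL1, ← lintegral_const_mul' _ _ ENNReal.ofReal_ne_top]
    calc A ≤ ∫⁻ s in Ioo t 1, ENNReal.ofReal (1 / t) * rearr f s := by
          refine setLIntegral_mono' measurableSet_Ioo fun s hs => ?_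
          exact mul_le_mul_left (ENNReal.ofReal_le_ofReal
            (one_div_le_one_div_of_le ht.1 hs.1.le)) _
      _ ≤ _ := lintegral_mono_set (Ioo_subset_Ioo_left ht.1.le)
  have hT := lintegral_triangle (measPos_rearr f) hbm.aemeasurable
  -- Tonelli's theorem evaluates `∫ₜ¹ f**(s) / s ds`
  have h1 : ∫⁻ s in Ioo t 1, ENNReal.ofReal (1 / s) * maxRearr f s =
      ∫⁻ r, rearr f r * ENNReal.ofReal (1 / max r t - 1) ∂unitMeasure := by
    calc ∫⁻ s in Ioo t 1, ENNReal.ofReal (1 / s) * maxRearr f s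
        = ∫⁻ s, b s * (∫⁻ r in Ioo 0 s, rearr f r) ∂unitMeasure := by
          rw [lintegral_Ioo_right ht.1.le]
          refine lintegral_congr_ae ?_
          filter_upwards [ae_mem_unit] with s hs
          by_cases hts : t < s
          · simp only [hb, indicator_apply, mem_Ioi, hts, if_true, maxRearr]
            rw [ENNReal.div_eq_inv_mul, ← ENNReal.ofReal_inv_of_pos hs.1, ← mul_assoc,
              ← ENNReal.ofReal_mul (by have := hs.1; positivity)]
            congr 2
            have := hs.1.ne'
            field_simp
          · simp [hb, hts]
      _ = _ := by
          rw [← hT]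
          refine lintegral_congr_ae ?_
          filter_upwards [ae_mem_unit] with r hr
          congr 1
          rw [← lintegral_one_div_sq (lt_max_of_lt_left hr.1) (max_le hr.2.le ht.2.le), hb,
            lintegral_indicator measurableSet_Ioi, Measure.restrict_restrict measurableSet_Ioi]
          congr 2
          ext s; simp [and_comm, and_assoc]
  have h2 : maxRearr f t + A ≤
      (∫⁻ s in Ioo t 1, ENNReal.ofReal (1 / s) * maxRearr f s) + normL1 f := by
    rw [h1, ← normL1_rearr hf, normL1, ← lintegral_add_right _ (measurable_rearr f)]
    have e1 : maxRearr f t = ∫⁻ s, (Iio t).indicator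
        (fun s => ENNReal.ofReal (1 / t) * rearr f s) s ∂unitMeasure := by
      rw [← lintegral_Ioo_left ht.2.le, lintegral_const_mul' _ _ ENNReal.ofReal_ne_top, maxRearr,
        div_eq_mul_inv, ← ENNReal.ofReal_inv_of_pos ht.1, mul_comm, one_div]
    rw [e1, hA, lintegral_Ioo_right ht.1.le, ← lintegral_add_left
      (((measurable_rearr f).const_mul _).indicator measurableSet_Iio)]
    refine lintegral_mono_ae ?_
    filter_upwards [ae_mem_unit] with r hr
    have hm : 1 ≤ 1 / max r t := by
      rw [le_div_iff₀ (lt_max_of_lt_left hr.1), one_mul]; exact max_le hr.2.le ht.2.le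
    have e2 : rearr f r * ENNReal.ofReal (1 / max r t - 1) + rearr f r =
        ENNReal.ofReal (1 / max r t) * rearr f r := by
      calc _ = (ENNReal.ofReal (1 / max r t - 1) + ENNReal.ofReal 1) * rearr f r := by
            rw [ENNReal.ofReal_one]; ring
        _ = _ := by
            rw [← ENNReal.ofReal_add (by linarith) zero_le_one]; congr 2; ring
    rw [e2]
    rcases lt_trichotomy r t with h | h | h
    · simp [h, h.le, h.not_gt]
    · simp [h]
    · simp [h, h.le, h.not_gt]
  have h3 : ∫⁻ s in Ioo t 1, ENNReal.ofReal (1 / s) * maxRearr f s ≤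
      opH I (oscillation I f) t + A := by
    have hm : Measurable fun s : ℝ => ENNReal.ofReal (1 / s) * rearr f s :=
      (by fun_prop : Measurable fun s : ℝ => ENNReal.ofReal (1 / s)).mul (measurable_rearr f)
    rw [hA, opH, ← lintegral_add_right _ hm]
    refine setLIntegral_mono' measurableSet_Ioo fun s hs => ?_
    have hs' : s ∈ Ioo (0 : ℝ) 1 := ⟨ht.1.trans hs.1, hs.2⟩
    have e : oscillation I f s / ENNReal.ofReal (I s) =
        ENNReal.ofReal (1 / s) * (maxRearr f s - rearr f s) := by
      rw [oscillation, div_eq_mul_inv, mul_right_comm, ← ENNReal.ofReal_inv_of_pos (hI.pos hs'),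
        ← ENNReal.ofReal_mul (div_pos (hI.pos hs') hs'.1).le]
      congr 2
      have := (hI.pos hs').ne'
      have := hs'.1.ne'
      field_simp
    rw [e, ← mul_add]
    gcongr
    exact le_tsub_add
  have h4 : maxRearr f t + A ≤ normL1 f + opH I (oscillation I f) t + A := by
    refine h2.trans ((add_le_add_left h3 _).trans (le_of_eq ?_))
    ring
  exact (ENNReal.add_le_add_iff_right hAfin).1 h4

/-- Every target space of `X` under `opH I` contains the functions with finite oscillation
functional. -/
lemma exists_le_oscillation_of_isBoundedOp (hI : ClassQ I) {Z : (ℝ → ℝ≥0∞) → ℝ≥0∞}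
    (hZ : IsRINorm Z) (hb : IsBoundedOp (opH I) X Z) :
    ∃ C : ℝ≥0, ∀ f, MeasPos f → Z f ≤ C * (X (oscillation I f) + normL1 f) := by
  obtain ⟨C, hC⟩ := hb
  obtain ⟨D, hD⟩ := ENNReal.lt_iff_exists_coe.1 hZ.one_lt_top
  refine ⟨C + D + 1, fun f hf => ?_⟩
  -- the summand `1` in the constant handles an infinite right-hand side
  rcases eq_or_ne (X (oscillation I f) + normL1 f) ∞ with htop | htop
  · rw [htop, ENNReal.mul_top (by simp)]; exact le_top
  obtain ⟨hosc, hL1⟩ := ENNReal.add_ne_top.1 htop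
  have hom : MeasPos (opH I (oscillation I f)) := (opH_antitone I _).measurable.aemeasurable
  lift normL1 f to ℝ≥0 using hL1 with a ha
  calc Z f = Z (rearr f) := hZ.rearr_eq f hf
    _ ≤ Z (fun t => (a : ℝ≥0∞) * 1 + opH I (oscillation I f) t) := by
        refine hZ.mono _ _ (measPos_rearr f) (aemeasurable_const.add hom) ?_
        filter_upwards [ae_mem_unit] with t ht
        rw [mul_one, ha]
        exact (rearr_le_maxRearr f ht.1).trans
          (maxRearr_le_normL1_add_opH hI hf (ha ▸ ENNReal.coe_ne_top) ht)
    _ ≤ a * Z (fun _ => 1) + C * X (oscillation I f) := by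
        refine (hZ.add_le _ _ aemeasurable_const hom).trans (add_le_add ?_ ?_)
        · exact (hZ.smul a _ aemeasurable_const).le
        · exact hC _ (measPos_oscillation hI f) (lt_top_iff_ne_top.2 hosc)
    _ ≤ (C + D + 1 : ℝ≥0) * X (oscillation I f) + (C + D + 1 : ℝ≥0) * a := by
        rw [hD.1, mul_comm, add_comm]
        gcongr
        · rw [add_assoc]; exact le_self_add
        · rw [add_right_comm]; exact le_add_self
    _ = _ := by rw [mul_add]

/-! ### Concave majorants -/

/-- A concave majorant of a quasiconcave function `ψ` on `(0, 1)`, given as an infimum of affine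
functions. -/
def concaveMajorant (ψ : ℝ → ℝ) (t : ℝ) : ℝ := ⨅ s : Ioo (0 : ℝ) 1, (1 + t / s) * ψ s

section ConcaveMajorant

variable {ψ : ℝ → ℝ}

instance : Nonempty (Ioo (0 : ℝ) 1) := ⟨⟨1 / 2, by norm_num, by norm_num⟩⟩

lemma one_add_div_mul_nonneg (h0 : ∀ t ∈ Ioo (0 : ℝ) 1, 0 ≤ ψ t) {t : ℝ} (ht : 0 ≤ t)
    (s : Ioo (0 : ℝ) 1) : 0 ≤ (1 + t / s) * ψ s :=
  mul_nonneg (add_nonneg zero_le_one (div_nonneg ht s.2.1.le)) (h0 s s.2)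

lemma concaveMajorant_le (h0 : ∀ t ∈ Ioo (0 : ℝ) 1, 0 ≤ ψ t) {t : ℝ} (ht : 0 ≤ t)
    (s : Ioo (0 : ℝ) 1) : concaveMajorant ψ t ≤ (1 + t / s) * ψ s :=
  ciInf_le ⟨0, by rintro _ ⟨s, rfl⟩; exact one_add_div_mul_nonneg h0 ht s⟩ s

lemma concaveMajorant_nonneg (h0 : ∀ t ∈ Ioo (0 : ℝ) 1, 0 ≤ ψ t) {t : ℝ} (ht : 0 ≤ t) :
    0 ≤ concaveMajorant ψ t :=
  le_ciInf fun s => one_add_div_mul_nonneg h0 ht s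

lemma concaveMajorant_le_two_mul (h0 : ∀ t ∈ Ioo (0 : ℝ) 1, 0 ≤ ψ t) {t : ℝ}
    (ht : t ∈ Ioo (0 : ℝ) 1) : concaveMajorant ψ t ≤ 2 * ψ t := by
  refine (concaveMajorant_le h0 ht.1.le ⟨t, ht⟩).trans (le_of_eq ?_)
  rw [div_self ht.1.ne']; ring

lemma le_concaveMajorant (h0 : ∀ t ∈ Ioo (0 : ℝ) 1, 0 ≤ ψ t) (hmono : MonotoneOn ψ (Ioo 0 1))
    (hdiv : ∀ s ∈ Ioo (0 : ℝ) 1, ∀ a ∈ Ioo (0 : ℝ) 1, s ≤ a → s * ψ a ≤ a * ψ s) {t : ℝ}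
    (ht : t ∈ Ioo (0 : ℝ) 1) : ψ t ≤ concaveMajorant ψ t := by
  refine le_ciInf fun s => ?_
  have hs := h0 s s.2
  have hts : 0 ≤ t / s := div_nonneg ht.1.le s.2.1.le
  rcases le_total t s with h | h
  · nlinarith [hmono ht s.2 h]
  · have := hdiv s s.2 t ht h
    have h2 : ψ t ≤ t / s * ψ s := by
      rw [div_mul_eq_mul_div, le_div_iff₀ s.2.1]; linarith
    linarith

lemma concaveMajorant_mono (h0 : ∀ t ∈ Ioo (0 : ℝ) 1, 0 ≤ ψ t) {t u : ℝ} (ht : 0 ≤ t)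
    (htu : t ≤ u) : concaveMajorant ψ t ≤ concaveMajorant ψ u :=
  le_ciInf fun s => (concaveMajorant_le h0 ht s).trans (by
    have := h0 s s.2
    have := s.2.1
    gcongr)

lemma mul_concaveMajorant_le (h0 : ∀ t ∈ Ioo (0 : ℝ) 1, 0 ≤ ψ t) {t u : ℝ} (ht : 0 < t)
    (htu : t ≤ u) : t * concaveMajorant ψ u ≤ u * concaveMajorant ψ t := by
  rw [← div_le_iff₀' (ht.trans_le htu)]
  refine le_ciInf fun s => ?_
  rw [div_le_iff₀' (ht.trans_le htu)]
  have h1 := concaveMajorant_le h0 (ht.le.trans htu) s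
  have h2 : t * (1 + u / s) ≤ u * (1 + t / s) := by
    have : t * (u / s) = u * (t / s) := by ring
    linarith
  calc t * concaveMajorant ψ u ≤ t * ((1 + u / s) * ψ s) := by gcongr
    _ = t * (1 + u / s) * ψ s := by ring
    _ ≤ u * (1 + t / s) * ψ s := mul_le_mul_of_nonneg_right h2 (h0 s s.2)
    _ = _ := by ring

lemma concaveOn_concaveMajorant (h0 : ∀ t ∈ Ioo (0 : ℝ) 1, 0 ≤ ψ t) :
    ConcaveOn ℝ (Ici 0) (concaveMajorant ψ) := by
  refine ⟨convex_Ici 0, fun x hx y hy a b ha hb hab => le_ciInf fun s => ?_⟩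
  simp only [smul_eq_mul]
  calc a * concaveMajorant ψ x + b * concaveMajorant ψ y
      ≤ a * ((1 + x / s) * ψ s) + b * ((1 + y / s) * ψ s) := by
        gcongr
        · exact concaveMajorant_le h0 hx s
        · exact concaveMajorant_le h0 hy s
    _ = ((a + b) + (a * x + b * y) / s) * ψ s := by ring
    _ = _ := by rw [hab]

/-- The chord slope of the concave majorant over `[t / 2, t]`, a substitute for its derivative. The
value `∞` at `t ≤ 0` makes the function antitone on the whole line. -/
def dyadicSlope (ψ : ℝ → ℝ) (t : ℝ) : ℝ≥0∞ :=
  if t ≤ 0 then ∞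
  else ENNReal.ofReal (2 * (concaveMajorant ψ t - concaveMajorant ψ (t / 2)) / t)

lemma antitone_dyadicSlope (h0 : ∀ t ∈ Ioo (0 : ℝ) 1, 0 ≤ ψ t) : Antitone (dyadicSlope ψ) := by
  intro t u htu
  rcases le_or_gt t 0 with ht | ht
  · simp [dyadicSlope, ht]
  rcases htu.eq_or_lt with rfl | hlt
  · exact le_rfl
  have hu := ht.trans hlt
  simp only [dyadicSlope, not_le.2 ht, not_le.2 hu, if_false]
  refine ENNReal.ofReal_le_ofReal ?_
  have hc := concaveOn_concaveMajorant h0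
  have e : ∀ x : ℝ, 0 < x → 2 * (concaveMajorant ψ x - concaveMajorant ψ (x / 2)) / x =
      slope (concaveMajorant ψ) (x / 2) x := fun x hx => by
    rw [slope_def_field]
    have := hx.ne'
    field_simp
    ring
  rw [e t ht, e u hu]
  have ht2 : t / 2 ∈ Ici (0 : ℝ) := by simp only [mem_Ici]; linarith
  calc slope (concaveMajorant ψ) (u / 2) u = slope (concaveMajorant ψ) u (u / 2) := slope_comm _ _ _
    _ ≤ slope (concaveMajorant ψ) u (t / 2) := by
        refine hc.slope_anti hu.le ⟨ht2, ?_⟩ ⟨?_, ?_⟩ (by linarith)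
        · simp only [mem_singleton_iff]; linarith
        · simp only [mem_Ici]; linarith
        · simp only [mem_singleton_iff]; linarith
    _ = slope (concaveMajorant ψ) (t / 2) u := slope_comm _ _ _
    _ ≤ slope (concaveMajorant ψ) (t / 2) t := by
        refine hc.slope_anti ht2 ⟨ht.le, ?_⟩ ⟨hu.le, ?_⟩ hlt.le
        · simp only [mem_singleton_iff]; linarith
        · simp only [mem_singleton_iff]; linarith

lemma lintegral_Ioo_two_mul (w : ℝ → ℝ≥0∞) (a : ℝ) :
    ∫⁻ t in Ioo 0 a, w t = ∫⁻ t in Ioo 0 (a / 2), 2 * w (2 * t) := by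
  have himg : (fun t : ℝ => 2 * t) '' Ioo 0 (a / 2) = Ioo 0 a := by
    rw [image_mul_left_Ioo two_pos]; congr 1 <;> ring
  rw [← himg, lintegral_image_eq_lintegral_abs_deriv_mul measurableSet_Ioo
    (f := fun t : ℝ => 2 * t) (f' := fun _ => 2 * 1)
    (fun x _ => ((hasDerivAt_id x).const_mul 2).hasDerivWithinAt)
    (mul_right_injective₀ two_ne_zero).injOn]
  simp

/-- The primitive of `dyadicSlope` telescopes, leaving an integral over the last dyadic block. The
integrability hypothesis excludes a jump of the concave majorant at `0`. -/
lemma lintegral_dyadicSlope (h0 : ∀ t ∈ Ioo (0 : ℝ) 1, 0 ≤ ψ t) {a : ℝ} (ha : a ∈ Ioo (0 : ℝ) 1)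
    (hfin : ∫⁻ s in Ioo 0 a, ENNReal.ofReal (ψ s / s) ≠ ∞) :
    ∫⁻ t in Ioo 0 a, dyadicSlope ψ t =
      ∫⁻ t in Ico (a / 2) a, ENNReal.ofReal (2 * concaveMajorant ψ t / t) := by
  set w : ℝ → ℝ≥0∞ := fun t => ENNReal.ofReal (2 * concaveMajorant ψ t / t) with hw
  have ha0 := ha.1
  have h1 : ∫⁻ t in Ioo 0 a, w t =
      (∫⁻ t in Ioo 0 a, dyadicSlope ψ t) + ∫⁻ t in Ioo 0 (a / 2), w t := by
    have e : ∫⁻ t in Ioo 0 (a / 2), w t =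
        ∫⁻ t in Ioo 0 a, ENNReal.ofReal (2 * concaveMajorant ψ (t / 2) / t) := by
      rw [lintegral_Ioo_two_mul _ a]
      refine setLIntegral_congr_fun measurableSet_Ioo fun t ht => ?_
      have h2 : (2 : ℝ≥0∞) = ENNReal.ofReal 2 := by simp
      simp only [hw]
      rw [h2, ← ENNReal.ofReal_mul zero_le_two]
      congr 1
      have := ht.1.ne'
      rw [mul_div_cancel_left₀ t two_ne_zero]
      field_simp
    rw [e, ← lintegral_add_left (antitone_dyadicSlope h0).measurable]
    refine setLIntegral_congr_fun measurableSet_Ioo fun t ht => ?_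
    have ht0 := ht.1
    simp only [dyadicSlope, not_le.2 ht0, if_false, hw]
    rw [← ENNReal.ofReal_add]
    · congr 1; ring
    · have := concaveMajorant_mono h0 (by linarith : 0 ≤ t / 2) (by linarith : t / 2 ≤ t)
      have : 0 ≤ concaveMajorant ψ t - concaveMajorant ψ (t / 2) := by linarith
      positivity
    · have := concaveMajorant_nonneg h0 (by linarith : 0 ≤ t / 2)
      positivity
  have h2 : ∫⁻ t in Ioo 0 a, w t =
      (∫⁻ t in Ico (a / 2) a, w t) + ∫⁻ t in Ioo 0 (a / 2), w t := by
    rw [add_comm, ← lintegral_union measurableSet_Ico, Ioo_union_Ico_eq_Ioo (by linarith)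
      (by linarith)]
    rw [Set.disjoint_left]
    exact fun x hx hx' => absurd hx.2 (not_lt.2 hx'.1)
  have h3 : ∫⁻ t in Ioo 0 (a / 2), w t ≠ ∞ := by
    refine ne_top_of_le_ne_top (ENNReal.mul_ne_top (ENNReal.ofReal_ne_top (r := 4)) hfin) ?_
    rw [← lintegral_const_mul' _ _ ENNReal.ofReal_ne_top]
    calc ∫⁻ t in Ioo 0 (a / 2), w t ≤ ∫⁻ t in Ioo 0 a, w t :=
          lintegral_mono_set (Ioo_subset_Ioo_right (by linarith))
      _ ≤ _ := by
          refine setLIntegral_mono' measurableSet_Ioo fun t ht => ?_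
          rw [← ENNReal.ofReal_mul (by norm_num)]
          refine ENNReal.ofReal_le_ofReal ?_
          have ht' : t ∈ Ioo (0 : ℝ) 1 := ⟨ht.1, ht.2.trans ha.2⟩
          have := concaveMajorant_le_two_mul h0 ht'
          rw [← mul_div_assoc]
          exact div_le_div_of_nonneg_right (by linarith) ht.1.le
  exact (ENNReal.add_left_inj h3).1 (h1.symm.trans h2)

/-- A quasiconcave function is equivalent to the primitive of a nonincreasing function, provided
that it vanishes fast enough at `0`. -/
lemma exists_antitone_primitive (h0 : ∀ t ∈ Ioo (0 : ℝ) 1, 0 ≤ ψ t)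
    (hmono : MonotoneOn ψ (Ioo 0 1))
    (hdiv : ∀ s ∈ Ioo (0 : ℝ) 1, ∀ a ∈ Ioo (0 : ℝ) 1, s ≤ a → s * ψ a ≤ a * ψ s)
    (hfin : ∀ a ∈ Ioo (0 : ℝ) 1, ∫⁻ s in Ioo 0 a, ENNReal.ofReal (ψ s / s) ≠ ∞) :
    ∃ g : ℝ → ℝ≥0∞, Antitone g ∧ ∀ a ∈ Ioo (0 : ℝ) 1,
      ENNReal.ofReal (ψ a) ≤ ∫⁻ t in Ioo 0 a, g t ∧
      ∫⁻ t in Ioo 0 a, g t ≤ 4 * ENNReal.ofReal (ψ a) := by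
  refine ⟨dyadicSlope ψ, antitone_dyadicSlope h0, fun a ha => ?_⟩
  have ha0 := ha.1
  have hψ := h0 a ha
  have hG := le_concaveMajorant h0 hmono hdiv ha
  have hconst : ∀ c : ℝ, 0 ≤ c → ∫⁻ _ in Ico (a / 2) a, ENNReal.ofReal (c / a) =
      ENNReal.ofReal (c / 2) := fun c hc => by
    rw [setLIntegral_const, Real.volume_Ico, ← ENNReal.ofReal_mul (by positivity)]
    congr 1
    field_simp
    ring
  rw [lintegral_dyadicSlope h0 ha (hfin a ha)]
  constructor
  · calc ENNReal.ofReal (ψ a) = ∫⁻ _ in Ico (a / 2) a, ENNReal.ofReal (2 * ψ a / a) := by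
          rw [hconst _ (by positivity)]; congr 1; ring
      _ ≤ _ := by
          refine setLIntegral_mono' measurableSet_Ico fun t ht => ENNReal.ofReal_le_ofReal ?_
          have ht0 : 0 < t := by linarith [ht.1]
          have h := mul_concaveMajorant_le h0 ht0 ht.2.le
          rw [div_le_div_iff₀ ha0 ht0]
          nlinarith
  · calc _ ≤ ∫⁻ _ in Ico (a / 2) a, ENNReal.ofReal (8 * ψ a / a) := by
          refine setLIntegral_mono' measurableSet_Ico fun t ht => ENNReal.ofReal_le_ofReal ?_
          have ht0 : 0 < t := by linarith [ht.1]
          have h1 := concaveMajorant_mono h0 ht0.le ht.2.le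
          have h2 := concaveMajorant_le_two_mul h0 ha
          rw [div_le_div_iff₀ ht0 ha0]
          nlinarith [ht.1]
      _ = 4 * ENNReal.ofReal (ψ a) := by
          rw [hconst _ (by positivity)]
          have : (4 : ℝ≥0∞) = ENNReal.ofReal 4 := by simp
          rw [this, ← ENNReal.ofReal_mul (by norm_num)]
          congr 1; ring

end ConcaveMajorant

/-! ### The tail operator -/

/-- The function `t ∫ₜ¹ I(s) h(s) / s² ds`. -/
def tailOp (I : ℝ → ℝ) (h : ℝ → ℝ≥0∞) (t : ℝ) : ℝ≥0∞ :=
  ENNReal.ofReal t * ∫⁻ s in Ioo t 1, ENNReal.ofReal (I s / s ^ 2) * h s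

/-- The operator `h ↦ (t / I(t)) ∫ₜ¹ I(s) h(s) / s² ds`, bounded on `L¹` and on `L^∞`. -/
def averageTailOp (I : ℝ → ℝ) (h : ℝ → ℝ≥0∞) (t : ℝ) : ℝ≥0∞ :=
  tailOp I h t / ENNReal.ofReal (I t)

lemma measurable_tailOp (I : ℝ → ℝ) (h : ℝ → ℝ≥0∞) : Measurable (tailOp I h) :=
  ENNReal.measurable_ofReal.mul
    (Antitone.measurable fun _ _ h => lintegral_mono_set (Ioo_subset_Ioo_left h))

lemma measPos_averageTailOp (hI : ClassQ I) (h : ℝ → ℝ≥0∞) : MeasPos (averageTailOp I h) :=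
  (measurable_tailOp I h).aemeasurable.div hI.aemeasurable.ennreal_ofReal

lemma measPos_weight (hI : ClassQ I) : MeasPos fun s => ENNReal.ofReal (I s / s ^ 2) :=
  (hI.aemeasurable.div (aemeasurable_id.pow_const 2)).ennreal_ofReal

/-- The bound of `averageTailOp` on `L^∞`, in terms of `tailOp`. -/
lemma exists_tailOp_le (hI : ClassQ I) : ∃ C : ℝ≥0, ∀ (c : ℝ≥0∞) (h : ℝ → ℝ≥0∞),
    (∀ x, h x ≤ c) → ∀ t ∈ Ioo (0 : ℝ) 1, tailOp I h t ≤ C * c * ENNReal.ofReal (I t) := by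
  obtain ⟨C₁, h₁⟩ := hI.integral_div_le
  obtain ⟨C₂, h₂⟩ := hI.integral_div_sq_le
  refine ⟨C₂ * C₁, fun c h hc t ht => ?_⟩
  have e : ENNReal.ofReal t * ENNReal.ofReal (1 / t) = 1 := by
    rw [← ENNReal.ofReal_mul ht.1.le, mul_one_div_cancel ht.1.ne', ENNReal.ofReal_one]
  have hm : AEMeasurable (fun s => ENNReal.ofReal (I s / s ^ 2)) (volume.restrict (Ioo t 1)) :=
    (measPos_weight hI).mono_measure (Measure.restrict_mono_set _ (Ioo_subset_Ioo_left ht.1.le))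
  calc tailOp I h t ≤ ENNReal.ofReal t * ∫⁻ s in Ioo t 1, ENNReal.ofReal (I s / s ^ 2) * c := by
        unfold tailOp; gcongr; exact hc _
    _ = ENNReal.ofReal t * ((∫⁻ s in Ioo t 1, ENNReal.ofReal (I s / s ^ 2)) * c) := by
        rw [lintegral_mul_const'' _ hm]
    _ ≤ ENNReal.ofReal t * ((C₂ * (ENNReal.ofReal (1 / t) * (C₁ * ENNReal.ofReal (I t)))) * c) := by
        gcongr
        refine (h₂ t ht).trans ?_
        gcongr
        exact h₁ t ht
    _ = (ENNReal.ofReal t * ENNReal.ofReal (1 / t)) * (C₂ * C₁ * c * ENNReal.ofReal (I t)) := by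
        ring
    _ = _ := by rw [e, one_mul, ENNReal.coe_mul]

lemma averageTailOp_add (hI : ClassQ I) {u : ℝ → ℝ≥0∞} (hu : MeasPos u) (v : ℝ → ℝ≥0∞) {t : ℝ}
    (ht : 0 ≤ t) :
    averageTailOp I (fun x => u x + v x) t = averageTailOp I u t + averageTailOp I v t := by
  have hm : AEMeasurable (fun s => ENNReal.ofReal (I s / s ^ 2) * u s)
      (volume.restrict (Ioo t 1)) :=
    ((measPos_weight hI).mul hu).mono_measure
      (Measure.restrict_mono_set _ (Ioo_subset_Ioo_left ht))
  simp only [averageTailOp, tailOp, mul_add]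
  rw [lintegral_add_left' hm, mul_add, ENNReal.add_div]

lemma averageTailOp_mono {u v : ℝ → ℝ≥0∞} (h : ∀ x, u x ≤ v x) (t : ℝ) :
    averageTailOp I u t ≤ averageTailOp I v t :=
  ENNReal.div_le_div_right (mul_le_mul_right
    (lintegral_mono fun s => mul_le_mul_right (h s) _) _) _

/-- The bound of `averageTailOp` on `L¹`. -/
lemma lintegral_averageTailOp_le (hI : ClassQ I) {v : ℝ → ℝ≥0∞} (hv : MeasPos v) :
    ∫⁻ t, averageTailOp I v t ∂unitMeasure ≤ ∫⁻ t, v t ∂unitMeasure := by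
  have ha : MeasPos fun t => ENNReal.ofReal t / ENNReal.ofReal (I t) :=
    ENNReal.measurable_ofReal.aemeasurable.div hI.aemeasurable.ennreal_ofReal
  have hb : MeasPos fun s => ENNReal.ofReal (I s / s ^ 2) * v s := (measPos_weight hI).mul hv
  have e : ∀ t, averageTailOp I v t = ENNReal.ofReal t / ENNReal.ofReal (I t) *
      ∫⁻ s in Ioo t 1, ENNReal.ofReal (I s / s ^ 2) * v s := fun t => by
    simp only [averageTailOp, tailOp, div_eq_mul_inv]; ring
  simp_rw [e]
  rw [lintegral_triangle ha hb]
  refine lintegral_mono_ae ?_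
  filter_upwards [ae_mem_unit] with s hs
  have hIs := hI.pos hs
  have hs0 := hs.1
  have h1 : ∫⁻ t in Ioo 0 s, ENNReal.ofReal t / ENNReal.ofReal (I t) ≤
      ENNReal.ofReal (s / I s * s) := by
    calc _ ≤ ∫⁻ t in Ioo 0 s, ENNReal.ofReal (s / I s) := by
          refine setLIntegral_mono' measurableSet_Ioo fun t ht => ?_
          have ht' : t ∈ Ioo (0 : ℝ) 1 := ⟨ht.1, ht.2.trans hs.2⟩
          have hIt := hI.pos ht'
          rw [← ENNReal.ofReal_div_of_pos hIt]
          refine ENNReal.ofReal_le_ofReal ?_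
          have h := hI.antitoneOn_div ht' hs ht.2.le
          simp only at h
          rw [div_le_div_iff₀ hs0 ht.1] at h
          rw [div_le_div_iff₀ hIt hIs]
          linarith
      _ = _ := by
          rw [setLIntegral_const, Real.volume_Ioo, sub_zero, ← ENNReal.ofReal_mul (by positivity)]
  calc _ ≤ ENNReal.ofReal (I s / s ^ 2) * v s * ENNReal.ofReal (s / I s * s) :=
        mul_le_mul_right h1 _
    _ = ENNReal.ofReal (I s / s ^ 2 * (s / I s * s)) * v s := by
        rw [ENNReal.ofReal_mul (p := I s / s ^ 2) (by positivity)]; ring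
    _ = v s := by
        have : I s / s ^ 2 * (s / I s * s) = 1 := by field_simp
        rw [this, ENNReal.ofReal_one, one_mul]

/-- Being bounded on `L¹` and on `L^∞`, the operator `averageTailOp` is bounded on every
rearrangement-invariant space; here on associate spaces. -/
lemma exists_assoc_averageTailOp_le (hI : ClassQ I) (hX : IsRINorm X) :
    ∃ C : ℝ≥0, ∀ h, MeasPos h → assoc X (averageTailOp I h) ≤ C * assoc X h := by
  obtain ⟨C, hC⟩ := exists_tailOp_le hI
  refine ⟨C + 1, fun h hh => assoc_le fun u hu hu1 => ?_⟩
  set A := averageTailOp I h with hA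
  have hAm : MeasPos A := measPos_averageTailOp hI h
  have key : ∀ t ∈ Ioc (0 : ℝ) 1, ∫⁻ s in Ioo 0 t, rearr A s ≤
      ∫⁻ s in Ioo 0 t, ((C + 1 : ℝ≥0) : ℝ≥0∞) * rearr h s := fun t ht => by
    -- truncation at the height `h*(t)` splits `h` into an integrable and a bounded part
    set c := rearr h t
    have hpt : ∀ᵐ s ∂unitMeasure, A s - C * c ≤ averageTailOp I (fun x => h x - c) s := by
      filter_upwards [ae_mem_unit] with s hs
      rw [tsub_le_iff_right]
      calc A s ≤ averageTailOp I (fun x => (h x - c) + c) s :=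
            averageTailOp_mono (fun x => le_tsub_add) s
        _ = averageTailOp I (fun x => h x - c) s + averageTailOp I (fun _ => c) s :=
            averageTailOp_add hI (hh.sub_const c) _ hs.1.le
        _ ≤ _ := by
            gcongr
            exact ENNReal.div_le_of_le_mul (hC c _ (fun _ => le_rfl) s hs)
    rw [lintegral_const_mul' _ _ ENNReal.coe_ne_top, lintegral_rearr_eq hh ht.2]
    calc ∫⁻ s in Ioo 0 t, rearr A s
        ≤ ∫⁻ x, (A x - C * c) ∂unitMeasure + C * c * ENNReal.ofReal t :=
          lintegral_rearr_le hAm ht.2 _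
      _ ≤ ∫⁻ x, (h x - c) ∂unitMeasure + C * c * ENNReal.ofReal t := by
          gcongr ?_ + _
          exact (lintegral_mono_ae hpt).trans (lintegral_averageTailOp_le hI (hh.sub_const c))
      _ ≤ ((C + 1 : ℝ≥0) : ℝ≥0∞) * ∫⁻ x, (h x - c) ∂unitMeasure +
          ((C + 1 : ℝ≥0) : ℝ≥0∞) * (c * ENNReal.ofReal t) := by
          rw [ENNReal.coe_add, ENNReal.coe_one, add_mul, one_mul, add_mul, ← mul_assoc, one_mul]
          exact add_le_add le_add_self le_self_add
      _ = _ := by rw [mul_add]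
  calc ∫⁻ t, A t * u t ∂unitMeasure ≤ ∫⁻ t, rearr A t * rearr u t ∂unitMeasure :=
        lintegral_mul_le_rearr hAm hu
    _ ≤ ∫⁻ t, ((C + 1 : ℝ≥0) : ℝ≥0∞) * rearr h t * rearr u t ∂unitMeasure :=
        lintegral_mul_le_of_antitone (measPos_rearr A) ((measPos_rearr h).const_mul _)
          (rearr_antitone u) key
    _ = ((C + 1 : ℝ≥0) : ℝ≥0∞) * ∫⁻ t, rearr u t * rearr h t ∂unitMeasure := by
        rw [← lintegral_const_mul' _ _ ENNReal.coe_ne_top]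
        refine lintegral_congr fun t => by ring
    _ ≤ _ := by gcongr; exact lintegral_rearr_mul_le_assoc hX hu hh hu1

lemma mul_tailOp_le (h : ℝ → ℝ≥0∞) {s a : ℝ} (hsa : s ≤ a) :
    ENNReal.ofReal s * tailOp I h a ≤ ENNReal.ofReal a * tailOp I h s := by
  unfold tailOp
  rw [mul_left_comm]
  gcongr

/-- Although `averageTailOp I h` need not be monotone, its rearrangement at `a / 3` is at least half
of its value at `a`, since on `(a / 2, a)` it stays above half of that value. -/
lemma tailOp_le_rearr (hI : ClassQ I) (h : ℝ → ℝ≥0∞) {a : ℝ} (ha : a ∈ Ioo (0 : ℝ) 1) :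
    tailOp I h a ≤ 6 * (ENNReal.ofReal (I (a / 3)) * rearr (averageTailOp I h) (a / 3)) := by
  have ha0 := ha.1
  have ha3 : a / 3 ∈ Ioo (0 : ℝ) 1 := ⟨by linarith, by linarith [ha.2]⟩
  have hIa := hI.pos ha
  have hden : 2 * ENNReal.ofReal (I a) ≠ 0 := mul_ne_zero two_ne_zero (hI.ofReal_pos ha)
  have hden' : 2 * ENNReal.ofReal (I a) ≠ ∞ := ENNReal.mul_ne_top (by simp) ENNReal.ofReal_ne_top
  -- on `(a / 2, a)` the averaged tail stays above half of its value at `a`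
  have h1 : tailOp I h a / (2 * ENNReal.ofReal (I a)) ≤ rearr (averageTailOp I h) (a / 3) := by
    refine le_of_forall_lt fun r hr => ?_
    rw [lt_rearr_iff]
    have hsub : Ioo (a / 2) a ⊆ {x | r < averageTailOp I h x} := fun s hs => by
      have hs' : s ∈ Ioo (0 : ℝ) 1 := ⟨by linarith [hs.1], hs.2.trans ha.2⟩
      refine hr.trans_le ?_
      rw [averageTailOp, ENNReal.le_div_iff_mul_le (Or.inl (hI.ofReal_pos hs'))
        (Or.inl ENNReal.ofReal_ne_top), mul_comm, ← mul_div_assoc]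
      refine ENNReal.div_le_of_le_mul ?_
      have h2 : tailOp I h a ≤ 2 * tailOp I h s := by
        unfold tailOp
        rw [← mul_assoc]
        refine mul_le_mul' ?_ (lintegral_mono_set (Ioo_subset_Ioo_left hs.2.le))
        have : (2 : ℝ≥0∞) = ENNReal.ofReal 2 := by simp
        rw [this, ← ENNReal.ofReal_mul zero_le_two]
        exact ENNReal.ofReal_le_ofReal (by linarith [hs.1])
      calc ENNReal.ofReal (I s) * tailOp I h a ≤ ENNReal.ofReal (I a) * (2 * tailOp I h s) :=
            mul_le_mul' (ENNReal.ofReal_le_ofReal (hI.monotoneOn hs' ha hs.2.le)) h2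
        _ = _ := by ring
    refine lt_of_lt_of_le ?_ (measure_mono hsub)
    rw [unitMeasure, Measure.restrict_apply measurableSet_Ioo, inter_eq_self_of_subset_left
      (Ioo_subset_Ioo (by linarith) ha.2.le), Real.volume_Ioo]
    exact (ENNReal.ofReal_lt_ofReal_iff (by linarith)).2 (by linarith)
  have h2 : ENNReal.ofReal (I a) ≤ 3 * ENNReal.ofReal (I (a / 3)) := by
    have : (3 : ℝ≥0∞) = ENNReal.ofReal 3 := by simp
    rw [this, ← ENNReal.ofReal_mul (by norm_num)]
    refine ENNReal.ofReal_le_ofReal ?_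
    have h := hI.antitoneOn_div ha3 ha (by linarith)
    simp only at h
    rw [div_le_div_iff₀ ha0 ha3.1] at h
    nlinarith
  rw [ENNReal.div_le_iff hden hden'] at h1
  calc tailOp I h a ≤ rearr (averageTailOp I h) (a / 3) * (2 * ENNReal.ofReal (I a)) := h1
    _ ≤ rearr (averageTailOp I h) (a / 3) * (2 * (3 * ENNReal.ofReal (I (a / 3)))) := by gcongr
    _ = (2 * 3) * (ENNReal.ofReal (I (a / 3)) * rearr (averageTailOp I h) (a / 3)) := by ring
    _ = _ := by norm_num

/-- The least nondecreasing majorant of `tailOp I h`. -/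
def tailSup (I : ℝ → ℝ) (h : ℝ → ℝ≥0∞) (t : ℝ) : ℝ≥0∞ := ⨆ a ∈ Ioc 0 t, tailOp I h a

lemma tailSup_mono (h : ℝ → ℝ≥0∞) : Monotone (tailSup I h) := fun _ _ htu =>
  biSup_mono fun _ ha => ⟨ha.1, ha.2.trans htu⟩

lemma tailOp_le_tailSup (h : ℝ → ℝ≥0∞) {t : ℝ} (ht : 0 < t) : tailOp I h t ≤ tailSup I h t :=
  le_biSup (tailOp I h) (show t ∈ Ioc 0 t from ⟨ht, le_rfl⟩)

/-- Together with `tailSup_mono`, quasiconcavity of `tailSup`. -/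
lemma mul_tailSup_le (h : ℝ → ℝ≥0∞) {s a : ℝ} (hs : 0 < s) (hsa : s ≤ a) :
    ENNReal.ofReal s * tailSup I h a ≤ ENNReal.ofReal a * tailSup I h s := by
  rw [show tailSup I h a = ⨆ b ∈ Ioc 0 a, tailOp I h b from rfl]
  simp_rw [ENNReal.mul_iSup]
  refine iSup₂_le fun b hb => ?_
  rcases le_total b s with hbs | hbs
  · exact mul_le_mul' (ENNReal.ofReal_le_ofReal hsa) (tailOp_le_tailSup h hb.1 |>.trans
      (tailSup_mono h hbs))
  · exact (mul_tailOp_le h hbs).trans (mul_le_mul' (ENNReal.ofReal_le_ofReal hb.2)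
      (tailOp_le_tailSup h hs))

lemma tailSup_le_opS (hI : ClassQ I) (h : ℝ → ℝ≥0∞) {t : ℝ} (ht : t ∈ Ioo (0 : ℝ) 1) :
    tailSup I h t ≤ 6 * opS I (averageTailOp I h) t * ENNReal.ofReal (I t) := by
  rw [opS, mul_assoc, ENNReal.div_mul_cancel (hI.ofReal_pos ht) ENNReal.ofReal_ne_top]
  refine iSup₂_le fun a ha => (tailOp_le_rearr hI h ⟨ha.1, ha.2.trans_lt ht.2⟩).trans ?_
  gcongr
  exact le_biSup (fun s => ENNReal.ofReal (I s) * rearr (averageTailOp I h) s)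
    (show a / 3 ∈ Ioc 0 t from ⟨by linarith [ha.1], by linarith [ha.1, ha.2]⟩)

/-- The supremum operator controls a nonincreasing weight whose primitive dominates the tail of
`h`. -/
lemma exists_antitone_tailOp_le (hI : ClassQ I) {h : ℝ → ℝ≥0∞} {n : ℕ} (hn : ∀ x, h x ≤ n) :
    ∃ g : ℝ → ℝ≥0∞, Antitone g ∧ ∀ a ∈ Ioo (0 : ℝ) 1,
      tailOp I h a ≤ ∫⁻ t in Ioo 0 a, g t ∧
      opHDual I g a ≤ 24 * opS I (averageTailOp I h) a := by
  obtain ⟨C, hC⟩ := exists_tailOp_le hI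
  obtain ⟨D, hD⟩ := hI.integral_div_le
  have hle : ∀ t ∈ Ioo (0 : ℝ) 1, tailSup I h t ≤ C * n * ENNReal.ofReal (I t) := fun t ht =>
    iSup₂_le fun a ha => by
      have ha' : a ∈ Ioo (0 : ℝ) 1 := ⟨ha.1, ha.2.trans_lt ht.2⟩
      refine (hC n h hn a ha').trans ?_
      gcongr
      exact hI.monotoneOn ha' ht ha.2
  have hfin : ∀ t ∈ Ioo (0 : ℝ) 1, tailSup I h t ≠ ∞ := fun t ht =>
    ne_top_of_le_ne_top (by finiteness) (hle t ht)
  have hof : ∀ t ∈ Ioo (0 : ℝ) 1, ENNReal.ofReal (tailSup I h t).toReal = tailSup I h t :=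
    fun t ht => ENNReal.ofReal_toReal (hfin t ht)
  obtain ⟨g, hg, hgb⟩ := exists_antitone_primitive (ψ := fun t => (tailSup I h t).toReal)
    (fun t _ => ENNReal.toReal_nonneg)
    (fun t _ u hu htu => ENNReal.toReal_mono (hfin u hu) (tailSup_mono h htu))
    (fun s hs a ha hsa => by
      have := ENNReal.toReal_mono (ENNReal.mul_ne_top ENNReal.ofReal_ne_top (hfin s hs))
        (mul_tailSup_le (I := I) h hs.1 hsa)
      rwa [ENNReal.toReal_mul, ENNReal.toReal_mul, ENNReal.toReal_ofReal hs.1.le,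
        ENNReal.toReal_ofReal ha.1.le] at this)
    (fun a ha => by
      refine ne_top_of_le_ne_top (b := C * n * (D * ENNReal.ofReal (I a))) (by finiteness) ?_
      refine le_trans ?_ (mul_le_mul_right (hD a ha) _)
      rw [← lintegral_const_mul' _ _ (by finiteness)]
      refine setLIntegral_mono' measurableSet_Ioo fun s hs => ?_
      have hs' : s ∈ Ioo (0 : ℝ) 1 := ⟨hs.1, hs.2.trans ha.2⟩
      rw [ENNReal.ofReal_div_of_pos hs.1, ENNReal.ofReal_div_of_pos hs.1, hof s hs',
        ← mul_div_assoc]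
      exact ENNReal.div_le_div_right (hle s hs') _)
  refine ⟨g, hg, fun a ha => ?_⟩
  obtain ⟨h1, h2⟩ := hgb a ha
  rw [hof a ha] at h1 h2
  refine ⟨(tailOp_le_tailSup h ha.1).trans h1, ENNReal.div_le_of_le_mul (h2.trans ?_)⟩
  calc 4 * tailSup I h a ≤ 4 * (6 * opS I (averageTailOp I h) a * ENNReal.ofReal (I a)) := by
        gcongr; exact tailSup_le_opS hI h ha
    _ = (4 * 6) * opS I (averageTailOp I h) a * ENNReal.ofReal (I a) := by ring
    _ = _ := by norm_num

/-! ### The oscillation functional is bounded by the optimal norm -/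

/-- The level `l` contributes `min (|{f > l}|) t` to `∫₀ᵗ f*`; the levels with `|{f > l}| > t` sum up
to `t f*(t)`, the others to `t (f**(t) - f*(t))`. -/
lemma lintegral_rearr_eq_layer (f : ℝ → ℝ≥0∞) {t : ℝ} (ht : t ∈ Ioo (0 : ℝ) 1) :
    ∫⁻ s in Ioo 0 t, rearr f s =
      (∫⁻ l in Ioi (0 : ℝ),
        {l : ℝ | (unitMeasure {x | ENNReal.ofReal l < f x}).toReal ≤ t}.indicator
          (fun l => unitMeasure {x | ENNReal.ofReal l < f x}) l) +
      rearr f t * ENNReal.ofReal t := by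
  have hm : Measurable fun l : ℝ => ENNReal.ofReal t *
      {l : ℝ | ENNReal.ofReal l < rearr f t}.indicator (fun _ => (1 : ℝ≥0∞)) l :=
    (measurable_const.indicator
      (measurableSet_lt ENNReal.measurable_ofReal measurable_const)).const_mul _
  have e : rearr f t * ENNReal.ofReal t = ∫⁻ l in Ioi (0 : ℝ), ENNReal.ofReal t *
      {l : ℝ | ENNReal.ofReal l < rearr f t}.indicator (fun _ => (1 : ℝ≥0∞)) l := by
    have hs : MeasurableSet {l : ℝ | ENNReal.ofReal l < rearr f t} :=
      measurableSet_lt ENNReal.measurable_ofReal measurable_const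
    rw [lintegral_const_mul' _ _ ENNReal.ofReal_ne_top, lintegral_indicator hs, setLIntegral_const,
      Measure.restrict_apply hs, inter_comm, volume_Ioi_inter_ofReal_lt, one_mul, mul_comm]
  rw [e, ← lintegral_add_right _ hm, lintegral_layer (measurable_rearr f).aemeasurable]
  refine lintegral_congr fun l => ?_
  have hm : MeasurableSet {s | ENNReal.ofReal l < rearr f s} := measurableSet_lt measurable_const
    (measurable_rearr f)
  set m := unitMeasure {x | ENNReal.ofReal l < f x} with hmdef
  have h1 : {s | ENNReal.ofReal l < rearr f s} ∩ Ioo 0 t = Ioo 0 (min m.toReal t) := by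
    rw [← max_self (0 : ℝ), ← Ioo_inter_Ioo, max_self, ← setOf_lt_rearr, inter_assoc,
      inter_eq_self_of_subset_right (Ioo_subset_Ioo_right ht.2.le)]
  rw [Measure.restrict_apply hm, h1, Real.volume_Ioo, sub_zero]
  simp only [indicator_apply, mem_ofPred_eq, lt_rearr_iff, ← hmdef]
  have hmt : m ≠ ∞ := measure_ne_top _ _
  rcases le_or_gt m.toReal t with h | h
  · have h' : ¬ ENNReal.ofReal t < m := by
      rw [ENNReal.ofReal_lt_iff_lt_toReal ht.1.le hmt]; exact not_lt.2 h
    simp [h, h', ENNReal.ofReal_toReal hmt]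
  · have h' : ENNReal.ofReal t < m := (ENNReal.ofReal_lt_iff_lt_toReal ht.1.le hmt).2 h
    simp [h.le, h.not_ge, h']

/-- The pairing of the oscillation with `h` is a superposition of tails of `h` over the levels
of `f`. -/
lemma lintegral_oscillation_mul_le (hI : ClassQ I) (f : ℝ → ℝ≥0∞) {h : ℝ → ℝ≥0∞}
    (hh : MeasPos h) :
    ∫⁻ t, oscillation I f t * h t ∂unitMeasure ≤
      ∫⁻ l in Ioi (0 : ℝ), tailOp I h (unitMeasure {x | ENNReal.ofReal l < f x}).toReal := by
  set m : ℝ → ℝ≥0∞ := fun l => unitMeasure {x | ENNReal.ofReal l < f x} with hm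
  have hmm : Measurable m := Antitone.measurable fun a b hab =>
    measure_mono fun x hx => lt_of_le_of_lt (ENNReal.ofReal_le_ofReal hab) hx
  have hmt : ∀ l, m l ≠ ∞ := fun l => measure_ne_top _ _
  have hS : MeasurableSet {p : ℝ × ℝ | (m p.2).toReal ≤ p.1} :=
    measurableSet_le (hmm.ennreal_toReal.comp measurable_snd) measurable_fst
  have hw := (measPos_weight hI).mul hh
  set k : ℝ → ℝ → ℝ≥0∞ := fun t l => {p : ℝ × ℝ | (m p.2).toReal ≤ p.1}.indicator
    (fun p => ENNReal.ofReal (I p.1 / p.1 ^ 2) * h p.1 * m p.2) (t, l) with hk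
  calc ∫⁻ t, oscillation I f t * h t ∂unitMeasure
      ≤ ∫⁻ t, (∫⁻ l in Ioi (0 : ℝ), k t l) ∂unitMeasure := by
        refine lintegral_mono_ae ?_
        filter_upwards [ae_mem_unit] with t ht
        have hIt := hI.pos ht
        have ht0 := ht.1
        have h1 : maxRearr f t - rearr f t ≤ (∫⁻ l in Ioi (0 : ℝ),
            {l : ℝ | (m l).toReal ≤ t}.indicator m l) / ENNReal.ofReal t := by
          rw [tsub_le_iff_right, maxRearr, lintegral_rearr_eq_layer f ht, ENNReal.add_div,
            ENNReal.mul_div_cancel_right (by simpa using ht0) ENNReal.ofReal_ne_top]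
        have e : ∫⁻ l in Ioi (0 : ℝ), k t l = ENNReal.ofReal (I t / t ^ 2) * h t *
            ∫⁻ l in Ioi (0 : ℝ), {l : ℝ | (m l).toReal ≤ t}.indicator m l := by
          rw [← lintegral_const_mul _ (hmm.indicator
            (measurableSet_le hmm.ennreal_toReal measurable_const))]
          refine lintegral_congr fun l => ?_
          by_cases h : (m l).toReal ≤ t <;> simp [hk, indicator_apply, h]
        rw [e, oscillation]
        calc _ ≤ ENNReal.ofReal (I t / t) * ((∫⁻ l in Ioi (0 : ℝ),
              {l : ℝ | (m l).toReal ≤ t}.indicator m l) / ENNReal.ofReal t) * h t := by gcongr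
          _ = (ENNReal.ofReal (I t / t) * (ENNReal.ofReal t)⁻¹) * h t * ∫⁻ l in Ioi (0 : ℝ),
              {l : ℝ | (m l).toReal ≤ t}.indicator m l := by rw [ENNReal.div_eq_inv_mul]; ring
          _ = _ := by
              rw [← ENNReal.ofReal_inv_of_pos ht0, ← ENNReal.ofReal_mul (by positivity)]
              congr 3
              field_simp
    _ = ∫⁻ l in Ioi (0 : ℝ), ∫⁻ t, k t l ∂unitMeasure := by
        rw [lintegral_lintegral_swap]
        exact (hw.comp_fst.mul hmm.aemeasurable.comp_snd).indicator hS
    _ ≤ _ := by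
        refine lintegral_mono fun l => ?_
        have e : ∀ t, k t l = m l *
            (Ici (m l).toReal).indicator (fun t => ENNReal.ofReal (I t / t ^ 2) * h t) t := by
          intro t
          by_cases h : (m l).toReal ≤ t <;> simp [hk, indicator_apply, h, mul_comm]
        simp_rw [e]
        rw [lintegral_const_mul' _ _ (hmt l), lintegral_indicator measurableSet_Ici, tailOp,
          ENNReal.ofReal_toReal (hmt l)]
        refine mul_le_mul_right ?_ _
        rw [setLIntegral_unitMeasure measurableSet_Ici]
        calc _ ≤ ∫⁻ t in Ico (m l).toReal 1, ENNReal.ofReal (I t / t ^ 2) * h t :=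
              lintegral_mono_set fun x hx => ⟨hx.1, hx.2.2⟩
          _ = _ := by rw [restrict_Ico_eq_restrict_Ioc, restrict_Ioo_eq_restrict_Ioc]

/-- The weight `g` attached to a test function `h` in the unit ball of the associate space is
admissible for `targetNorm`, up to a constant, because `opS I` is bounded on that space. -/
lemma exists_oscillation_le_targetNorm (hI : ClassQ I) (hX : IsRINorm X)
    (hS : IsBoundedOp (opS I) (assoc X) (assoc X)) :
    ∃ C : ℝ≥0, ∀ f, MeasPos f → X (oscillation I f) ≤ C * targetNorm I X f := by
  obtain ⟨A, hA⟩ := exists_assoc_averageTailOp_le hI hX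
  obtain ⟨B, hB⟩ := hS
  set M : ℝ≥0 := 24 * (B * A) + 1 with hM
  have hM0 : M ≠ 0 := by positivity
  refine ⟨M, fun f hf => le_of_forall_assoc_le_one hX (measPos_oscillation hI f)
    fun h hh ⟨n, hn⟩ h1 => ?_⟩
  obtain ⟨g, hg, hgb⟩ := exists_antitone_tailOp_le hI hn
  have hA1 : assoc X (averageTailOp I h) ≤ A := by
    calc _ ≤ A * assoc X h := hA h hh.aemeasurable
      _ ≤ A * 1 := by gcongr
      _ = A := mul_one _
  have hS1 : assoc X (opS I (averageTailOp I h)) ≤ B * A :=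
    (hB _ (measPos_averageTailOp hI h) (hA1.trans_lt ENNReal.coe_lt_top)).trans (by gcongr)
  have hg1 : assoc X (opHDual I fun t => ((M⁻¹ : ℝ≥0) : ℝ≥0∞) * g t) ≤ 1 := by
    calc _ ≤ assoc X (fun t => ((M⁻¹ * 24 : ℝ≥0) : ℝ≥0∞) * opS I (averageTailOp I h) t) := by
          refine assoc_mono ?_
          filter_upwards [ae_mem_unit] with t ht
          rw [opHDual, lintegral_const_mul' _ _ ENNReal.coe_ne_top, mul_div_assoc,
            ENNReal.coe_mul, mul_assoc]
          gcongr
          exact (hgb t ht).2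
      _ ≤ (M⁻¹ * 24 : ℝ≥0) * (B * A) := (assoc_const_mul_le _ _).trans (by gcongr)
      _ ≤ 1 := by
          rw [← ENNReal.coe_mul, ← ENNReal.coe_mul, ← ENNReal.coe_one, ENNReal.coe_le_coe,
            mul_assoc, inv_mul_le_iff₀ (by positivity), mul_one, hM]
          exact le_self_add
  have hprim : ∫⁻ l in Ioi (0 : ℝ), ∫⁻ t in Ioo 0 (unitMeasure {x | ENNReal.ofReal l < f x}).toReal,
      g t = ∫⁻ t, rearr f t * g t ∂unitMeasure := by
    rw [lintegral_mul_layer (measurable_rearr f) hg.measurable.aemeasurable]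
    refine lintegral_congr fun l => ?_
    rw [setLIntegral_unitMeasure (measurableSet_lt measurable_const (measurable_rearr f)),
      setOf_lt_rearr]
  calc ∫⁻ t, oscillation I f t * h t ∂unitMeasure
      ≤ ∫⁻ l in Ioi (0 : ℝ), tailOp I h (unitMeasure {x | ENNReal.ofReal l < f x}).toReal :=
        lintegral_oscillation_mul_le hI f hh.aemeasurable
    _ ≤ ∫⁻ t, rearr f t * g t ∂unitMeasure := by
        rw [← hprim]
        refine lintegral_mono fun l => ?_
        have hle : (unitMeasure {x | ENNReal.ofReal l < f x}).toReal ≤ 1 :=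
          ENNReal.toReal_le_of_le_ofReal zero_le_one (by simpa using prob_le_one)
        have hnn : 0 ≤ (unitMeasure {x | ENNReal.ofReal l < f x}).toReal := ENNReal.toReal_nonneg
        -- at the end points `0` and `1` the tail vanishes
        rcases hnn.eq_or_lt with h0 | h0
        · simp [← h0, tailOp]
        rcases hle.eq_or_lt with h1 | h1
        · simp [h1, tailOp]
        · exact (hgb _ ⟨h0, h1⟩).1
    _ = M * ∫⁻ t, rearr f t * (((M⁻¹ : ℝ≥0) : ℝ≥0∞) * g t) ∂unitMeasure := by
        rw [← lintegral_const_mul' _ _ ENNReal.coe_ne_top]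
        refine lintegral_congr fun t => ?_
        calc rearr f t * g t = ((M * M⁻¹ : ℝ≥0) : ℝ≥0∞) * (rearr f t * g t) := by
              rw [mul_inv_cancel₀ hM0, ENNReal.coe_one, one_mul]
          _ = _ := by rw [ENNReal.coe_mul]; ring
    _ ≤ M * targetNorm I X f := by
        gcongr
        exact le_targetNorm f (hg.const_mul' _) hg1

lemma exists_oscillation_add_normL1_le (hI : ClassQ I) (hX : IsRINorm X)
    (hS : IsBoundedOp (opS I) (assoc X) (assoc X)) :
    ∃ C : ℝ≥0, ∀ f, MeasPos f → X (oscillation I f) + normL1 f ≤ C * targetNorm I X f := by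
  obtain ⟨A, hA⟩ := exists_oscillation_le_targetNorm hI hX hS
  obtain ⟨B, hB⟩ := exists_normL1_le_targetNorm hI hX
  refine ⟨A + B, fun f hf => ?_⟩
  rw [ENNReal.coe_add, add_mul]
  exact add_le_add (hA f hf) (hB f hf)

/-- The dual construction yields an optimal target space. -/
lemma isOptimalTarget_targetNorm (hI : ClassQ I) (hX : IsRINorm X)
    (hS : IsBoundedOp (opS I) (assoc X) (assoc X)) :
    IsOptimalTarget (opH I) X (targetNorm I X) := by
  refine ⟨isRINorm_targetNorm hI hX, isBoundedOp_targetNorm hI hX, fun Z hZ hb => ?_⟩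
  obtain ⟨A, hA⟩ := exists_le_oscillation_of_isBoundedOp hI hZ hb
  obtain ⟨B, hB⟩ := exists_oscillation_add_normL1_le hI hX hS
  refine ⟨A * B, fun f hf _ => (hA f hf).trans ?_⟩
  rw [ENNReal.coe_mul, mul_assoc]
  gcongr
  exact hB f hf

end RISpace

end

theorem mainTheorem7 (I : ℝ → ℝ) (hI : RISpace.ClassQ I)
    (X : (ℝ → ℝ≥0∞) → ℝ≥0∞) (hX : RISpace.IsRINorm X)
    (hS : RISpace.IsBoundedOp (RISpace.opS I) (RISpace.assoc X) (RISpace.assoc X)) :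
    (∃ Y : (ℝ → ℝ≥0∞) → ℝ≥0∞, RISpace.IsOptimalTarget (RISpace.opH I) X Y) ∧
    ∀ Y : (ℝ → ℝ≥0∞) → ℝ≥0∞, RISpace.IsOptimalTarget (RISpace.opH I) X Y →
      ∃ C : ℝ≥0, ∀ f : ℝ → ℝ≥0∞, RISpace.MeasPos f →
        Y f ≤ C * (X (fun t => ENNReal.ofReal (I t / t) *
              (RISpace.maxRearr f t - RISpace.rearr f t)) + RISpace.normL1 f) ∧
        X (fun t => ENNReal.ofReal (I t / t) *
              (RISpace.maxRearr f t - RISpace.rearr f t)) + RISpace.normL1 f ≤ C * Y f := by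
  have hopt := RISpace.isOptimalTarget_targetNorm hI hX hS
  refine ⟨⟨_, hopt⟩, fun Y ⟨hY, hYb, hYopt⟩ => ?_⟩
  obtain ⟨A, hA⟩ := RISpace.exists_le_oscillation_of_isBoundedOp hI hY hYb
  obtain ⟨B, hB⟩ := RISpace.exists_oscillation_add_normL1_le hI hX hS
  obtain ⟨D, hD⟩ := hYopt _ hopt.1 hopt.2.1
  refine ⟨A + B * D + 1, fun f hf => ⟨(hA f hf).trans ?_, ?_⟩⟩
  · rw [add_assoc, ENNReal.coe_add]
    exact mul_le_mul_left le_self_add _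
  -- the summand `1` in the constant handles `Y f = ∞`
  · rcases eq_or_ne (Y f) ∞ with htop | htop
    · rw [htop, ENNReal.mul_top (by simp)]; exact le_top
    · calc _ ≤ B * RISpace.targetNorm I X f := hB f hf
        _ ≤ B * (D * Y f) := by gcongr; exact hD f hf (lt_top_iff_ne_top.2 htop)
        _ = (B * D : ℝ≥0) * Y f := by rw [ENNReal.coe_mul, mul_assoc]
        _ ≤ _ := by gcongr; rw [add_right_comm]; exact le_add_self
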